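/- Let $\mathbb k$ be a field and $q\in\mathbb k^\times$. Let $\mathcal K$ be the skew field of fractions of the $\mathbb k$-algebra (an Ore domain) generated by $h_1,h_2,e_1,\dots,e_{11},x,y,\sigma_1,\sigma_2,\tau_1,\dots,\tau_{11}$ subject to $$yx=q\,xy,\qquad \tau_ie_i=q^{-1}e_i\tau_i\ (1\le i\le 11),\qquad \sigma_1h_2=q\,h_2\sigma_1,\qquad \sigma_2h_1=q\,h_1\sigma_2,$$ all other pairs of generators commuting. **Theorem.** There are unique $\mathbb k$-algebra automorphisms $s_0,\dots,s_8$ of $\mathcal K$ acting on the generators as follows (generators not listed are fixed; every quotient below is a quotient of commuting elements): $$s_0:\ e_{10}\mapsto\frac{h_2}{e_{11}},\quad e_{11}\mapsto\frac{h_2}{e_{10}},\quad h_1\mapsto\frac{h_1h_2}{e_{10}e_{11}},\quad x\mapsto x\,\frac{1+y\frac{h_2}{e_{10}}}{1+ye_{11}},$$ $$\tau_{10}\mapsto(1+ye_{11})\frac{\sigma_2}{\tau_{11}},\quad \tau_{11}\mapsto\frac{\sigma_2}{\tau_{10}}\Bigl(1+y\frac{h_2}{e_{10}}\Bigr),\quad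 \sigma_1\mapsto(1+ye_{11})\frac{\sigma_1\sigma_2}{\tau_{10}\tau_{11}};$$ $$s_3:\ e_1\mapsto\frac{h_1}{e_7},\quad e_7\mapsto\frac{h_1}{e_1},\quad h_2\mapsto\frac{h_1h_2}{e_1e_7},\quad y\mapsto\frac{1+x\frac{e_7}{h_1}}{1+\frac{x}{e_1}}\,y,$$ $$\tau_1\mapsto\Bigl(1+x\frac{e_7}{h_1}\Bigr)\frac{\sigma_1}{\tau_7},\quad \tau_7\mapsto\frac{\sigma_1}{\tau_1}\Bigl(1+\frac{x}{e_1}\Bigr),\quad \sigma_2\mapsto\frac{\sigma_1\sigma_2}{\tau_1\tau_7}\Bigl(1+\frac{x}{e_1}\Bigr);$$ and $s_1,s_2,s_4,s_5,s_6,s_7,s_8$ exchange $e_i\leftrightarrow e_j$, $\tau_i\leftrightarrow\tau_j$ for $(i,j)=(8,9),(7,8),(1,2),(2,3),(3,4),(4,5),(5,6)$ respectively. These automorphisms satisfy the Coxeter relations of type $E_8^{(1)}$, whose Dynkin diagram is the chain $1-2-3-4-5-6-7-8$ with the node $0$ attached to the node $3$: $s_i^2=1$; $s_is_js_i=s_js_is_j$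 (equivalently $(s_is_j)^3=1$) if $i,j$ are joined; and $s_is_j=s_js_i$ (equivalently $(s_is_j)^2=1$) if $i\ne j$ are not joined. Hence there is a group homomorphism from the affine Weyl group $W(E_8^{(1)})$ to $\mathrm{Aut}_{\mathbb k}(\mathcal K)$ sending the $i$-th simple reflection to $s_i$ $(0\le i\le 8)$. -/

import Mathlib

/-! ### The algebra of polynomials in `q`-commuting variables

For a finite index set `I`, a matrix `B` of exponents and a unit `q` of a field `𝕜`, `QPoly B q`
is the `𝕜`-algebra with basis the (ordered) monomials `X^a`, `a : I → ℕ`, and multiplication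
`X^a * X^b = q^(∑ i j, a i * b j * B i j) X^(a + b)`.  It is generated by the variables `X_i`,
subject exactly to `q^(B j i) X_i X_j = q^(B i j) X_j X_i`. -/

set_option linter.unusedSectionVars false

section QPoly

variable {𝕜 I : Type*} [Field 𝕜] [Fintype I]

/-- The exponent of `q` produced when the monomials `X^a` and `X^b` are multiplied. -/
def qExp (B : I → I → ℕ) (a b : I → ℕ) : ℕ := ∑ i, ∑ j, a i * b j * B i j

lemma qExp_add_left (B : I → I → ℕ) (a a' b : I → ℕ) :
    qExp B (a + a') b = qExp B a b + qExp B a' b := by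
  simp only [qExp, Pi.add_apply, add_mul, Finset.sum_add_distrib]

lemma qExp_add_right (B : I → I → ℕ) (a b b' : I → ℕ) :
    qExp B a (b + b') = qExp B a b + qExp B a b' := by
  simp only [qExp, Pi.add_apply, add_mul, mul_add, Finset.sum_add_distrib]

/-- Polynomials in the `q`-commuting variables `X_i`: finite `𝕜`-linear combinations of the
monomials `X^a`, `a : I → ℕ`. -/
def QPoly (_B : I → I → ℕ) (_q : 𝕜ˣ) : Type _ := (I → ℕ) →₀ 𝕜

namespace QPoly

variable {B : I → I → ℕ} {q : 𝕜ˣ}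

noncomputable instance : AddCommGroup (QPoly B q) :=
  inferInstanceAs (AddCommGroup ((I → ℕ) →₀ 𝕜))

noncomputable instance : Module 𝕜 (QPoly B q) :=
  inferInstanceAs (Module 𝕜 ((I → ℕ) →₀ 𝕜))

/-- The term `r X^a`. -/
noncomputable def monomial (a : I → ℕ) : 𝕜 →ₗ[𝕜] QPoly B q := Finsupp.lsingle a

/-- The variable `X_i`. -/
noncomputable def X [DecidableEq I] (i : I) : QPoly B q := monomial (Pi.single i 1) 1

/-- The coefficient of `X^a`. -/
def coeff (a : I → ℕ) : QPoly B q →ₗ[𝕜] 𝕜 := Finsupp.lapply a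

/-- The linear map sending `X^a` to `φ a`. -/
noncomputable def lin {M : Type*} [AddCommGroup M] [Module 𝕜 M] (φ : (I → ℕ) → M) :
    QPoly B q →ₗ[𝕜] M :=
  Finsupp.linearCombination 𝕜 φ

lemma lin_monomial {M : Type*} [AddCommGroup M] [Module 𝕜 M] (φ : (I → ℕ) → M) (a : I → ℕ)
    (r : 𝕜) : lin φ (monomial a r : QPoly B q) = r • φ a :=
  Finsupp.linearCombination_single 𝕜 r a

/-- The bilinear multiplication, `X^a * X^b = q^(qExp B a b) X^(a + b)`. -/
noncomputable def mulHom : QPoly B q →ₗ[𝕜] QPoly B q →ₗ[𝕜] QPoly B q :=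
  lin fun a => lin fun b => monomial (a + b) ((q : 𝕜) ^ qExp B a b)

noncomputable instance : Mul (QPoly B q) := ⟨fun f g => mulHom f g⟩

noncomputable instance : One (QPoly B q) := ⟨monomial 0 1⟩

lemma mul_def (f g : QPoly B q) : f * g = mulHom f g := rfl

lemma one_def : (1 : QPoly B q) = monomial 0 1 := rfl

lemma monomial_mul_monomial (a b : I → ℕ) (r s : 𝕜) :
    (monomial a r * monomial b s : QPoly B q)
      = monomial (a + b) (r * s * (q : 𝕜) ^ qExp B a b) := by
  rw [mul_def, mulHom, lin_monomial, LinearMap.smul_apply, lin_monomial, ← map_smul, ← map_smul]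
  congr 1
  simp only [smul_eq_mul]
  ring

@[elab_as_elim]
lemma induction {p : QPoly B q → Prop} (f : QPoly B q) (zero : p 0)
    (add : ∀ f g, p f → p g → p (f + g)) (mon : ∀ a r, p (monomial a r)) : p f :=
  Finsupp.induction_linear f zero add mon

noncomputable instance : Ring (QPoly B q) :=
  { (inferInstance : AddCommGroup (QPoly B q)) with
    mul := (· * ·)
    one := 1
    left_distrib := fun f g k => map_add (mulHom f) g k
    right_distrib := fun f g k => by simp only [mul_def, map_add, LinearMap.add_apply]
    zero_mul := fun f => by simp only [mul_def, map_zero, LinearMap.zero_apply]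
    mul_zero := fun f => by simp only [mul_def, map_zero]
    one_mul := fun f => by
      induction f using QPoly.induction with
      | zero => simp only [mul_def, map_zero]
      | add f g hf hg => simp only [mul_def, map_add] at *; rw [hf, hg]
      | mon a r => rw [one_def, monomial_mul_monomial]; simp [qExp]
    mul_one := fun f => by
      induction f using QPoly.induction with
      | zero => simp only [mul_def, map_zero, LinearMap.zero_apply]
      | add f g hf hg => simp only [mul_def, map_add, LinearMap.add_apply] at *; rw [hf, hg]
      | mon a r => rw [one_def, monomial_mul_monomial]; simp [qExp]
    mul_assoc := fun f g k => by
      induction f using QPoly.induction with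
      | zero => simp only [mul_def, map_zero, LinearMap.zero_apply]
      | add f f' hf hf' => simp only [mul_def, map_add, LinearMap.add_apply] at *; rw [hf, hf']
      | mon a r =>
      induction g using QPoly.induction with
      | zero => simp only [mul_def, map_zero, LinearMap.zero_apply]
      | add f f' hf hf' => simp only [mul_def, map_add, LinearMap.add_apply] at *; rw [hf, hf']
      | mon b s =>
      induction k using QPoly.induction with
      | zero => simp only [mul_def, map_zero]
      | add f f' hf hf' => simp only [mul_def, map_add] at *; rw [hf, hf']
      | mon c t =>
      simp only [monomial_mul_monomial, qExp_add_left, qExp_add_right, add_assoc, pow_add]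
      congr 1
      ring }

noncomputable instance : Algebra 𝕜 (QPoly B q) :=
  Algebra.ofModule
    (fun r f g => by simp only [mul_def, map_smul, LinearMap.smul_apply])
    (fun r f g => by simp only [mul_def, map_smul])

/-- The defining relations. -/
lemma X_mul_X [DecidableEq I] (i j : I) :
    (q : 𝕜) ^ B j i • (X i * X j : QPoly B q) = (q : 𝕜) ^ B i j • (X j * X i) := by
  have h : ∀ i j : I, qExp B (Pi.single i 1) (Pi.single j 1) = B i j := fun i j => by
    simp [qExp, Pi.single_apply, Finset.sum_ite_eq']
  simp only [X, monomial_mul_monomial, h, ← map_smul, smul_eq_mul, one_mul]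
  rw [add_comm, mul_comm]

lemma coeff_monomial [DecidableEq I] (a c : I → ℕ) (r : 𝕜) :
    coeff c (monomial a r : QPoly B q) = if a = c then r else 0 :=
  Finsupp.single_apply

lemma ext_coeff {f g : QPoly B q} (h : ∀ c, coeff c f = coeff c g) : f = g :=
  Finsupp.ext h

/-- The finite set of exponents of the monomials of `f`. -/
def support (f : QPoly B q) : Finset (I → ℕ) := Finsupp.support f

lemma mem_support {f : QPoly B q} {a : I → ℕ} : a ∈ f.support ↔ coeff a f ≠ 0 :=
  Finsupp.mem_support_iff

lemma sum_monomial (f : QPoly B q) : ∑ a ∈ f.support, monomial a (coeff a f) = f :=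
  Finsupp.sum_single f

lemma coeff_mul [DecidableEq I] (f g : QPoly B q) (c : I → ℕ) :
    coeff c (f * g) = ∑ a ∈ f.support, ∑ b ∈ g.support,
      if a + b = c then coeff a f * coeff b g * (q : 𝕜) ^ qExp B a b else 0 := by
  conv_lhs => rw [← sum_monomial f, ← sum_monomial g]
  simp only [Finset.sum_mul_sum, map_sum, monomial_mul_monomial, coeff_monomial]

instance : Nontrivial (QPoly B q) := by
  classical
  refine ⟨⟨0, 1, fun h => ?_⟩⟩
  have := congrArg (coeff 0) h
  simp [one_def, coeff_monomial] at this

instance : NoZeroDivisors (QPoly B q) := by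
  classical
  refine ⟨fun {f g} h => ?_⟩
  by_contra! hfg
  have ne : ∀ f : QPoly B q, f ≠ 0 → f.support.Nonempty := fun f hf => by
    rw [Finset.nonempty_iff_ne_empty]
    intro h
    exact hf (by rw [← sum_monomial f, h, Finset.sum_empty])
  obtain ⟨a, ha, b, hb, hab⟩ :=
    UniqueSums.uniqueAdd_of_nonempty (ne f hfg.1) (ne g hfg.2)
  have h0 := congrArg (coeff (a + b)) h
  rw [coeff_mul, map_zero, Finset.sum_eq_single_of_mem a ha, Finset.sum_eq_single_of_mem b hb,
    if_pos rfl] at h0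
  · exact mul_ne_zero (mul_ne_zero (mem_support.1 ha) (mem_support.1 hb))
      (pow_ne_zero _ q.ne_zero) h0
  · intro b' hb' hne
    exact if_neg fun e => hne (hab ha hb' e).2
  · intro a' ha' hne
    exact Finset.sum_eq_zero fun b' hb' => if_neg fun e => hne (hab ha' hb' e).1

instance : IsDomain (QPoly B q) := NoZeroDivisors.to_isDomain _

/-! The left Ore condition, by comparing the dimensions of spaces of polynomials of bounded
degree. -/

lemma exists_bound (f : QPoly B q) : ∃ N, ∀ c, coeff c f ≠ 0 → ∀ i, c i ≤ N := by
  refine ⟨∑ a ∈ f.support, ∑ i, a i, fun c hc i => ?_⟩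
  calc c i ≤ ∑ i, c i := Finset.single_le_sum (f := c) (fun _ _ => Nat.zero_le _) (Finset.mem_univ i)
    _ ≤ _ := Finset.single_le_sum (f := fun a : I → ℕ => ∑ i, a i) (fun _ _ => Nat.zero_le _)
      (mem_support.2 hc)

lemma bound_mul {f g : QPoly B q} {m n : ℕ} (hf : ∀ c, coeff c f ≠ 0 → ∀ i, c i ≤ m)
    (hg : ∀ c, coeff c g ≠ 0 → ∀ i, c i ≤ n) (c : I → ℕ) (hc : coeff c (f * g) ≠ 0) (i : I) :
    c i ≤ m + n := by
  classical
  rw [coeff_mul] at hc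
  obtain ⟨a, ha, h⟩ := Finset.exists_ne_zero_of_sum_ne_zero hc
  obtain ⟨b, hb, h⟩ := Finset.exists_ne_zero_of_sum_ne_zero h
  have : a + b = c := by
    by_contra e
    exact h (if_neg e)
  rw [← this]
  exact add_le_add (hf a (mem_support.1 ha) i) (hg b (mem_support.1 hb) i)

lemma exists_pow_lt (d N : ℕ) : ∃ n : ℕ, (n + N + 1) ^ d < 2 * (n + 1) ^ d := by
  have h1 : Filter.Tendsto (fun n : ℕ => (1 + (N : ℝ) * (1 / ((n : ℝ) + 1))) ^ d) Filter.atTop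
      (nhds ((1 + (N : ℝ) * 0) ^ d)) :=
    ((tendsto_one_div_add_atTop_nhds_zero_nat.const_mul (N : ℝ)).const_add 1).pow d
  have h2 := h1.eventually (gt_mem_nhds (show (1 + (N : ℝ) * 0) ^ d < 2 by simp))
  obtain ⟨n, hn⟩ := h2.exists
  refine ⟨n, ?_⟩
  have hpos : (0 : ℝ) < n + 1 := by positivity
  have : ((n : ℝ) + N + 1) ^ d < 2 * (n + 1) ^ d := by
    have e : (n : ℝ) + N + 1 = (1 + (N : ℝ) * (1 / ((n : ℝ) + 1))) * (n + 1) := by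
      field_simp
      ring
    rw [e, mul_pow]
    exact mul_lt_mul_of_pos_right hn (by positivity)
  exact_mod_cast this

lemma exists_ore (r s : QPoly B q) (hs : s ≠ 0) : ∃ u v : QPoly B q, u ≠ 0 ∧ u * r = v * s := by
  classical
  obtain ⟨N₁, h₁⟩ := exists_bound r
  obtain ⟨N₂, h₂⟩ := exists_bound s
  have h₁ : ∀ c, coeff c r ≠ 0 → ∀ i, c i ≤ max N₁ N₂ := fun c hc i =>
    (h₁ c hc i).trans (le_max_left _ _)
  have h₂ : ∀ c, coeff c s ≠ 0 → ∀ i, c i ≤ max N₁ N₂ := fun c hc i =>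
    (h₂ c hc i).trans (le_max_right _ _)
  generalize max N₁ N₂ = N at h₁ h₂
  obtain ⟨n, hn⟩ := exists_pow_lt (Fintype.card I) N
  let P : ((I → Fin (n + 1)) → 𝕜) →ₗ[𝕜] QPoly B q :=
    ∑ a : I → Fin (n + 1), (monomial fun i => (a i : ℕ)) ∘ₗ LinearMap.proj a
  have hP : ∀ w, P w = ∑ a : I → Fin (n + 1), monomial (fun i => (a i : ℕ)) (w a) := fun w => by
    simp [P, LinearMap.sum_apply]
  have hPb : ∀ w c, coeff c (P w) ≠ 0 → ∀ i, c i ≤ n := fun w c hc i => by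
    rw [hP, map_sum] at hc
    obtain ⟨a, -, h⟩ := Finset.exists_ne_zero_of_sum_ne_zero hc
    rw [coeff_monomial] at h
    have e : (fun i => (a i : ℕ)) = c := by
      by_contra e
      exact h (if_neg e)
    rw [← e]
    exact Nat.lt_succ_iff.1 (a i).2
  have hPi : ∀ w, P w = 0 → w = 0 := fun w hw => by
    funext a
    have h := congrArg (coeff fun i => (a i : ℕ)) hw
    rw [hP, map_sum, map_zero, Finset.sum_eq_single_of_mem a (Finset.mem_univ a),
      coeff_monomial, if_pos rfl] at h
    · exact h
    · intro b _ hb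
      rw [coeff_monomial]
      refine if_neg fun e => hb ?_
      funext i
      exact Fin.ext (congrFun e i)
  let T : (((I → Fin (n + 1)) → 𝕜) × ((I → Fin (n + 1)) → 𝕜)) →ₗ[𝕜]
      ((I → Fin (n + N + 1)) → 𝕜) :=
    LinearMap.pi fun c => coeff (fun i => (c i : ℕ)) ∘ₗ
      ((LinearMap.mulRight 𝕜 r ∘ₗ P) ∘ₗ LinearMap.fst 𝕜 _ _
        - (LinearMap.mulRight 𝕜 s ∘ₗ P) ∘ₗ LinearMap.snd 𝕜 _ _)
  have hT : ∀ w c, T w c = coeff (fun i => (c i : ℕ)) (P w.1 * r - P w.2 * s) := fun w c => rfl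
  have hker : LinearMap.ker T ≠ ⊥ := by
    apply LinearMap.ker_ne_bot_of_finrank_lt
    simp only [Module.finrank_prod, Module.finrank_fintype_fun_eq_card, Fintype.card_fun,
      Fintype.card_fin]
    omega
  obtain ⟨w, hw, hw0⟩ := (Submodule.ne_bot_iff _).1 hker
  have key : P w.1 * r = P w.2 * s := by
    rw [← sub_eq_zero]
    apply ext_coeff
    intro c
    rw [map_zero]
    by_contra hc
    have hcb : ∀ i, c i < n + N + 1 := by
      intro i
      rw [Nat.lt_succ_iff]
      by_cases hr : coeff c (P w.1 * r) = 0
      · by_cases hs : coeff c (P w.2 * s) = 0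
        · exact absurd (by rw [map_sub, hr, hs, sub_zero]) hc
        · exact bound_mul (hPb w.2) h₂ c hs i
      · exact bound_mul (hPb w.1) h₁ c hr i
    exact hc (congrFun (LinearMap.mem_ker.1 hw) fun i => ⟨c i, hcb i⟩)
  refine ⟨P w.1, P w.2, fun h0 => hw0 ?_, key⟩
  rw [h0, zero_mul] at key
  have h2 : P w.2 = 0 := (mul_eq_zero.1 key.symm).resolve_right hs
  exact Prod.ext (hPi _ h0) (hPi _ h2)

noncomputable instance : OreLocalization.OreSet (nonZeroDivisors (QPoly B q)) :=
  Classical.choice <| OreLocalization.nonempty_oreSet_iff_of_noZeroDivisors.2 fun r s => by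
    obtain ⟨u, v, hu, h⟩ := exists_ore r (s : QPoly B q) (nonZeroDivisors.ne_zero s.2)
    exact ⟨v, ⟨u, mem_nonZeroDivisors_of_ne_zero hu⟩, h⟩

end QPoly

/-- The skew field of fractions `s⁻¹ r` of the Ore domain `QPoly B q`. -/
abbrev QFrac (B : I → I → ℕ) (q : 𝕜ˣ) : Type _ :=
  OreLocalization (nonZeroDivisors (QPoly B q)) (QPoly B q)

end QPoly

/-! ### The skew field `K` and the action of the affine Weyl group -/

/-- The generators of `K`.  Indices are read modulo `2` and modulo `11`, so that the literals
`1, 2` enumerate `Fin 2` and the literals `1, …, 11` enumerate `Fin 11`. -/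
inductive Gen
  | h (i : Fin 2)
  | e (i : Fin 11)
  | x
  | y
  | σ (i : Fin 2)
  | τ (i : Fin 11)
  deriving DecidableEq, Fintype

/-- The exponents `B` for which the non-trivial relations `q^(B j i) X_i X_j = q^(B i j) X_j X_i`
are `y x = q x y`, `e_i τ_i = q τ_i e_i`, `σ₁ h₂ = q h₂ σ₁`, `σ₂ h₁ = q h₁ σ₂`. -/
def qWeight : Gen → Gen → ℕ
  | .y, .x => 1
  | .e i, .τ j => if i = j then 1 else 0
  | .σ i, .h j => if i = j then 0 else 1
  | _, _ => 0

/-- The skew field `K`, over the base field `𝕜` and with parameter `q`. -/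
abbrev SkewK {𝕜 : Type*} [Field 𝕜] (q : 𝕜ˣ) : Type _ := QFrac qWeight q

section Action

variable {𝕜 : Type*} [Field 𝕜] (q : 𝕜ˣ)

/-- The generators, as elements of `K`. -/
noncomputable def gen (g : Gen) : SkewK q :=
  OreLocalization.numeratorHom (QPoly.X g : QPoly qWeight q)

/-- The defining relations of `K`. -/
lemma gen_mul_gen (g g' : Gen) :
    (q : 𝕜) ^ qWeight g' g • (gen q g * gen q g')
      = (q : 𝕜) ^ qWeight g g' • (gen q g' * gen q g) := by
  have h : ∀ (r : 𝕜) (f : QPoly qWeight q), r • (OreLocalization.numeratorHom f : SkewK q)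
      = OreLocalization.numeratorHom (r • f) := fun r f => by
    rw [OreLocalization.numeratorHom_apply, OreLocalization.numeratorHom_apply,
      OreLocalization.smul_oreDiv_one]
  rw [gen, gen, ← map_mul, ← map_mul, h, h, QPoly.X_mul_X]

/-- The values of `s₀` on the generators (all the quotients are of commuting elements). -/
noncomputable def s₀Image : Gen → SkewK q :=
  let h := fun i => gen q (.h i)
  let e := fun i => gen q (.e i)
  let σ := fun i => gen q (.σ i)
  let τ := fun i => gen q (.τ i)
  let x := gen q .x
  let y := gen q .y
  fun g =>
    if g = .e 10 then h 2 / e 11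
    else if g = .e 11 then h 2 / e 10
    else if g = .h 1 then (h 1 * h 2) / (e 10 * e 11)
    else if g = .x then x * ((1 + y * (h 2 / e 10)) / (1 + y * e 11))
    else if g = .τ 10 then (1 + y * e 11) * (σ 2 / τ 11)
    else if g = .τ 11 then (σ 2 / τ 10) * (1 + y * (h 2 / e 10))
    else if g = .σ 1 then (1 + y * e 11) * ((σ 1 * σ 2) / (τ 10 * τ 11))
    else gen q g

/-- The values of `s₃` on the generators (all the quotients are of commuting elements). -/
noncomputable def s₃Image : Gen → SkewK q :=
  let h := fun i => gen q (.h i)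
  let e := fun i => gen q (.e i)
  let σ := fun i => gen q (.σ i)
  let τ := fun i => gen q (.τ i)
  let x := gen q .x
  let y := gen q .y
  fun g =>
    if g = .e 1 then h 1 / e 7
    else if g = .e 7 then h 1 / e 1
    else if g = .h 2 then (h 1 * h 2) / (e 1 * e 7)
    else if g = .y then ((1 + x * (e 7 / h 1)) / (1 + x / e 1)) * y
    else if g = .τ 1 then (1 + x * (e 7 / h 1)) * (σ 1 / τ 7)
    else if g = .τ 7 then (σ 1 / τ 1) * (1 + x / e 1)
    else if g = .σ 2 then ((σ 1 * σ 2) / (τ 1 * τ 7)) * (1 + x / e 1)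
    else gen q g

/-- The values on the generators of the exchange `e_i ↔ e_j`, `τ_i ↔ τ_j`. -/
noncomputable def swapImage (i j : Fin 11) : Gen → SkewK q
  | .e k => gen q (.e (Equiv.swap i j k))
  | .τ k => gen q (.τ (Equiv.swap i j k))
  | g => gen q g

/-- The values of `s₀, …, s₈` on the generators. -/
noncomputable def sImage : Fin 9 → Gen → SkewK q :=
  ![s₀Image q, swapImage q 8 9, swapImage q 7 8, s₃Image q, swapImage q 1 2, swapImage q 2 3,
    swapImage q 3 4, swapImage q 4 5, swapImage q 5 6]

end Action

/-- The edges of the Dynkin diagram of type `E₈⁽¹⁾`: the chain `1 - 2 - ⋯ - 8`, and `0 - 3`. -/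
def affineE₈Edge (i j : Fin 9) : Prop :=
  (i ≠ 0 ∧ (j : ℕ) = i + 1) ∨ (j ≠ 0 ∧ (i : ℕ) = j + 1) ∨ (i = 0 ∧ j = 3) ∨ (i = 3 ∧ j = 0)

instance : DecidableRel affineE₈Edge := fun i j => by unfold affineE₈Edge; infer_instance

/-- The Coxeter matrix of type `E₈⁽¹⁾`. -/
def affineE₈ : CoxeterMatrix (Fin 9) where
  M := Matrix.of fun i j => if i = j then 1 else if affineE₈Edge i j then 3 else 2
  isSymm := by decide
  diagonal := by decide
  off_diagonal := by
    intro i j hij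
    simp only [Matrix.of_apply, if_neg hij]
    split_ifs <;> decide

/-! The maps must first be shown to exist. Prescribed images of the generators define an
endomorphism of the skew field once they satisfy the defining relations and the induced map on the
Ore domain is injective, so that nonzero denominators become units. Injectivity comes from a
valuation: exponents are ordered lexicographically, those of $x$ and $y$ first. Then the sums
$F=1+y\,h_2/e_{10}$, $G=1+y\,e_{11}$ occurring in $s_0$ and $P=1+x\,e_7/h_1$, $Q=1+x/e_1$ occurring
in $s_3$ have value $0$, so the value of each image is the exponent of its monomial part. For $s_0$
and $s_3$ these exponents form an integer matrix of square $1$; hence distinct monomials have images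
of distinct values, and no nonzero polynomial is killed (`QFrac.lift_injective`, `exists_actsBy`).
This works for every $q$, roots of unity included. The same matrices preserve the skew form
governing $q$-commutation, so the relations hold for the monomial parts, and the sum factors add
only a few commutation identities.

An identity without sums in denominators compares sums of terms $q^nX^v$; `eq_of_terms` settles it
by comparing lists of exponents. In the other identities the sum factors are first cancelled by
division-ring algebra.

A homomorphism is determined by its values on the generators, so the Coxeter relations are checked
there. $s_0$ exchanges $F$ and $G$, and $s_3$ exchanges $P$ and $Q$, which makes them involutions;
the relations among the index swaps come from the symmetric group; those of $s_3$ with its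
neighbours in the chain telescope. The substantial relation is $s_0s_3s_0=s_3s_0s_3$. The generators
moved by $s_0$ are fixed by $s_3$, so on them the relation says that $s_3s_0(g)$ is $s_0$-invariant;
the roles are exchanged on the generators moved by $s_3$. Here $s_3(F)=Q^{-1}a$ and $s_3(G)=Q^{-1}b$
with $s_0(a)=a$ and $s_0(b)=b\,F/G$, and the extra factors cancel (`ActsBy.s₀_braid_s₃_left`); the
mirror image is `ActsBy.s₀_braid_s₃_right`. -/

section Lift

/-! ### Universal properties of the $q$-polynomial algebra and of its skew field of fractions. -/

variable {𝕜 I : Type*} [Field 𝕜] [Fintype I] {B : I → I → ℕ} {q : 𝕜ˣ}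

/-- The ordered product of the `f i ^ a i`, over the list `l`. -/
def orderedProd {A : Type*} [Monoid A] (f : I → A) (l : List I) (a : I → ℕ) : A :=
  (l.map fun i => f i ^ a i).prod

section

variable {A : Type*} [Ring A] [Algebra 𝕜 A] {f : I → A}

lemma pow_mul_pow_of_rel (hf : ∀ i j, (q : 𝕜) ^ B j i • (f i * f j) = (q : 𝕜) ^ B i j • (f j * f i))
    {i j : I} (hij : B i j = 0) (m n : ℕ) :
    f j ^ m * f i ^ n = (q : 𝕜) ^ (m * n * B j i) • (f i ^ n * f j ^ m) := by
  have h1 : f j * f i = (q : 𝕜) ^ B j i • (f i * f j) := by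
    rw [hf i j, hij, pow_zero, one_smul]
  have h2 : ∀ m, f j ^ m * f i = (q : 𝕜) ^ (m * B j i) • (f i * f j ^ m) := fun m => by
    induction m with
    | zero => simp
    | succ m ih =>
      rw [pow_succ', mul_assoc, ih, mul_smul_comm, ← mul_assoc, h1, smul_mul_assoc, smul_smul,
        mul_assoc, ← pow_add]
      congr 2
      ring
  induction n with
  | zero => simp
  | succ n ih =>
    rw [pow_succ, ← mul_assoc, ih, smul_mul_assoc, mul_assoc (f i ^ n), h2, mul_smul_comm, smul_smul,
      mul_assoc (f i ^ n), ← pow_add]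
    congr 2
    ring

lemma orderedProd_mul_pow
    (hf : ∀ i j, (q : 𝕜) ^ B j i • (f i * f j) = (q : 𝕜) ^ B i j • (f j * f i))
    {i : I} {l : List I} (hl : ∀ j ∈ l, B i j = 0) (a : I → ℕ) (n : ℕ) :
    orderedProd f l a * f i ^ n
      = (q : 𝕜) ^ (l.map fun j => a j * n * B j i).sum • (f i ^ n * orderedProd f l a) := by
  induction l with
  | nil => simp [orderedProd]
  | cons j l ih =>
    have ih := ih fun k hk => hl k (List.mem_cons_of_mem _ hk)
    have hj := pow_mul_pow_of_rel hf (hl j List.mem_cons_self) (a j) n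
    simp only [orderedProd, List.map_cons, List.prod_cons, List.sum_cons] at ih ⊢
    rw [mul_assoc, ih, mul_smul_comm, ← mul_assoc, hj, smul_mul_assoc, smul_smul, ← pow_add,
      mul_assoc (f i ^ n), add_comm]

/-- Only a later factor of the first product has to pass an earlier one of the second; each such
passage contributes a power of $q$. The pairs already in order contribute nothing because `B`
vanishes on them, so the exponent can be written as the full double sum that defines `qExp`. -/
lemma orderedProd_mul
    (hf : ∀ i j, (q : 𝕜) ^ B j i • (f i * f j) = (q : 𝕜) ^ B i j • (f j * f i))
    (hB : ∀ i, B i i = 0) {l : List I} (hl : l.Pairwise fun i j => B i j = 0) (a b : I → ℕ) :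
    orderedProd f l a * orderedProd f l b
      = (q : 𝕜) ^ (l.map fun i => (l.map fun j => a i * b j * B i j).sum).sum •
        orderedProd f l (a + b) := by
  induction l with
  | nil => simp [orderedProd]
  | cons i l ih =>
    rw [List.pairwise_cons] at hl
    have ih := ih hl.2
    have hi := orderedProd_mul_pow hf hl.1 a (b i)
    have h0 : (l.map fun j => a i * b j * B i j).sum = 0 :=
      List.sum_eq_zero fun x hx => by
        obtain ⟨j, hj, rfl⟩ := List.mem_map.1 hx
        rw [hl.1 j hj, mul_zero]
    simp only [orderedProd, List.map_cons, List.prod_cons, List.sum_cons, hB, mul_zero, h0,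
      zero_add, Pi.add_apply, List.sum_map_add] at ih hi ⊢
    rw [mul_assoc, ← mul_assoc _ (f i ^ b i), hi, smul_mul_assoc, mul_assoc, ih, mul_smul_comm,
      mul_smul_comm, mul_smul_comm, smul_smul, ← mul_assoc, ← pow_add, ← pow_add]

/-- An enumeration of `I` for which `B i j = 0` if `i` is not after `j`. -/
structure IsMonomialOrder (B : I → I → ℕ) (l : List I) : Prop where
  nodup : l.Nodup
  mem : ∀ i, i ∈ l
  diag : ∀ i, B i i = 0
  pairwise : l.Pairwise fun i j => B i j = 0

lemma IsMonomialOrder.sum_map {l : List I} (hl : IsMonomialOrder B l) {M : Type*}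
    [AddCommMonoid M] (u : I → M) : (l.map u).sum = ∑ i, u i := by
  classical
  rw [← List.sum_toFinset u hl.nodup]
  exact Finset.sum_congr (by ext i; simp [hl.mem]) fun _ _ => rfl

lemma IsMonomialOrder.orderedProd_single [DecidableEq I] {l : List I} (hl : IsMonomialOrder B l)
    {A : Type*} [Monoid A] (f : I → A) (i : I) : orderedProd f l (Pi.single i 1) = f i := by
  have h : ∀ l : List I, l.Nodup → orderedProd f l (Pi.single i 1) = if i ∈ l then f i else 1 := by
    intro l hl
    induction l with
    | nil => simp [orderedProd]
    | cons j l ih =>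
      rw [List.nodup_cons] at hl
      have ih := ih hl.2
      simp only [orderedProd, List.map_cons, List.prod_cons] at ih ⊢
      rw [ih]
      by_cases hij : i = j
      · subst hij
        simp [hl.1]
      · simp [hij, Ne.symm hij]
  rw [h l hl.nodup, if_pos (hl.mem i)]

/-- The universal property of the algebra of `q`-commuting polynomials. -/
noncomputable def QPoly.lift {l : List I} (hl : IsMonomialOrder B l) (f : I → A)
    (hf : ∀ i j, (q : 𝕜) ^ B j i • (f i * f j) = (q : 𝕜) ^ B i j • (f j * f i)) :
    QPoly B q →ₐ[𝕜] A :=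
  AlgHom.ofLinearMap (QPoly.lin (orderedProd f l))
    (by
      rw [QPoly.one_def, QPoly.lin_monomial, one_smul]
      exact List.prod_eq_one fun x hx => by
        obtain ⟨j, -, rfl⟩ := List.mem_map.1 hx
        simp)
    (fun x y => by
      induction x using QPoly.induction with
      | zero => simp
      | add x x' hx hx' => simp only [add_mul, map_add, hx, hx']
      | mon a r =>
      induction y using QPoly.induction with
      | zero => simp
      | add y y' hy hy' => simp only [mul_add, map_add, hy, hy']
      | mon b s =>
      rw [QPoly.monomial_mul_monomial, QPoly.lin_monomial, QPoly.lin_monomial, QPoly.lin_monomial,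
        smul_mul_smul_comm, orderedProd_mul hf hl.diag hl.pairwise, smul_smul, hl.sum_map]
      simp only [hl.sum_map, qExp])

lemma QPoly.lift_apply {l : List I} (hl : IsMonomialOrder B l) (f : I → A)
    (hf : ∀ i j, (q : 𝕜) ^ B j i • (f i * f j) = (q : 𝕜) ^ B i j • (f j * f i))
    (x : QPoly B q) : QPoly.lift hl f hf x = ∑ a ∈ x.support, coeff a x • orderedProd f l a := by
  conv_lhs => rw [← QPoly.sum_monomial x, map_sum]
  exact Finset.sum_congr rfl fun a _ => QPoly.lin_monomial _ _ _

lemma QPoly.lift_X [DecidableEq I] {l : List I} (hl : IsMonomialOrder B l) (f : I → A)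
    (hf : ∀ i j, (q : 𝕜) ^ B j i • (f i * f j) = (q : 𝕜) ^ B i j • (f j * f i))
    (i : I) : QPoly.lift hl f hf (QPoly.X i) = f i := by
  change QPoly.lin (orderedProd f l) (QPoly.monomial _ _) = _
  rw [QPoly.lin_monomial, one_smul, hl.orderedProd_single]

lemma QPoly.algHom_ext [DecidableEq I] {φ ψ : QPoly B q →ₐ[𝕜] A}
    (h : ∀ i, φ (QPoly.X i) = ψ (QPoly.X i)) : φ = ψ := by
  have key : ∀ n : ℕ, ∀ a : I → ℕ, ∑ i, a i = n →
      φ (QPoly.monomial a 1) = ψ (QPoly.monomial a 1) := by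
    intro n
    induction n with
    | zero =>
      intro a ha
      have : a = 0 := by
        funext i
        exact Finset.sum_eq_zero_iff.1 ha i (Finset.mem_univ i)
      rw [this, ← QPoly.one_def, map_one, map_one]
    | succ n ih =>
      intro a ha
      -- Split off one variable that occurs: $X_iX^{a-\delta_i}$ is $X^a$ up to a power of $q$,
      -- which is invertible.
      obtain ⟨i, -, hi⟩ := Finset.exists_ne_zero_of_sum_ne_zero (ha.trans_ne n.succ_ne_zero)
      have hab : Pi.single i 1 + (a - Pi.single i 1) = a := by
        funext j
        by_cases hj : j = i
        · subst hj
          simp only [Pi.add_apply, Pi.sub_apply, Pi.single_eq_same]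
          omega
        · simp [hj]
      have hn := ih (a - Pi.single i 1) (by
        rw [← hab] at ha
        have h1 : ∑ j, (Pi.single i 1 : I → ℕ) j = 1 := by simp [Pi.single_apply]
        simp only [Pi.add_apply, Finset.sum_add_distrib, h1] at ha
        omega)
      have hm : (QPoly.X i * QPoly.monomial (a - Pi.single i 1) 1 : QPoly B q)
          = (q : 𝕜) ^ qExp B (Pi.single i 1) (a - Pi.single i 1) • QPoly.monomial a 1 := by
        rw [QPoly.X, QPoly.monomial_mul_monomial, hab, ← map_smul]
        simp
      have h2 := congrArg φ hm
      have h3 := congrArg ψ hm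
      rw [map_mul, map_smul] at h2 h3
      rw [h, hn, h3] at h2
      exact (smul_right_injective A (pow_ne_zero _ q.ne_zero) h2).symm
  refine AlgHom.ext fun x => ?_
  rw [← QPoly.sum_monomial x, map_sum, map_sum]
  refine Finset.sum_congr rfl fun a _ => ?_
  rw [← mul_one (coeff a x), ← smul_eq_mul, map_smul, map_smul, map_smul, key _ a rfl]

end

namespace QFrac

/-- The inclusion of the polynomials into the skew field of fractions. -/
noncomputable def of : QPoly B q →ₐ[𝕜] QFrac B q :=
  { (OreLocalization.numeratorRingHom : QPoly B q →+* QFrac B q) with commutes' := fun _ => rfl }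

lemma of_apply (x : QPoly B q) : (of x : QFrac B q) = OreLocalization.numeratorHom x := rfl

lemma of_injective : Function.Injective (of : QPoly B q → QFrac B q) :=
  OreLocalization.numeratorHom_inj inf_le_left

lemma of_ne_zero {x : QPoly B q} (hx : x ≠ 0) : (of x : QFrac B q) ≠ 0 :=
  (map_ne_zero_iff _ of_injective).2 hx

lemma exists_of_mul_eq (z : QFrac B q) : ∃ s r : QPoly B q, s ≠ 0 ∧ of s * z = of r := by
  induction z using OreLocalization.ind with
  | _ r s =>
  refine ⟨s, r, nonZeroDivisors.ne_zero s.2, ?_⟩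
  rw [of_apply, of_apply, OreLocalization.numeratorHom_apply, OreLocalization.mul_cancel,
    OreLocalization.numeratorHom_apply]

variable {A : Type*} [DivisionRing A] [Algebra 𝕜 A]

/-- The extension of an injective homomorphism to the skew field of fractions. -/
noncomputable def lift (φ : QPoly B q →ₐ[𝕜] A) (hφ : Function.Injective φ) :
    QFrac B q →ₐ[𝕜] A :=
  { OreLocalization.universalHom (φ : QPoly B q →+* A)
      (Units.liftRight ((φ : QPoly B q →* A).comp (Submonoid.subtype _))
        (fun s => Units.mk0 (φ s) ((map_ne_zero_iff _ hφ).2 (nonZeroDivisors.ne_zero s.2)))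
        (fun _ => rfl)) (fun _ => rfl) with
    commutes' := fun r => by
      refine (OreLocalization.universalHom_commutes _ _ _).trans ?_
      exact φ.commutes r }

lemma lift_of (φ : QPoly B q →ₐ[𝕜] A) (hφ : Function.Injective φ) (x : QPoly B q) :
    lift φ hφ (of x) = φ x :=
  OreLocalization.universalHom_commutes _ _ _

lemma algHom_ext [DecidableEq I] {φ ψ : QFrac B q →ₐ[𝕜] A}
    (h : ∀ i, φ (of (QPoly.X i)) = ψ (of (QPoly.X i))) : φ = ψ := by
  have h' : φ.comp of = ψ.comp of := QPoly.algHom_ext h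
  refine AlgHom.ext fun z => ?_
  obtain ⟨s, r, hs, e⟩ := exists_of_mul_eq z
  have h1 := congrArg φ e
  have h2 := congrArg ψ e
  rw [map_mul, show φ (of s) = ψ (of s) from DFunLike.congr_fun h' s,
    show φ (of r) = ψ (of r) from DFunLike.congr_fun h' r, ← h2, map_mul] at h1
  exact mul_left_cancel₀ ((map_ne_zero ψ).2 (of_ne_zero hs)) h1

end QFrac

end Lift

/-! ### Monomial valuations on the skew field and the injectivity criterion. -/

section Valuation

variable {𝕜 I Γ : Type*} [Field 𝕜] [Fintype I] {B : I → I → ℕ} {q : 𝕜ˣ}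
  [AddCommGroup Γ] [LinearOrder Γ] [IsOrderedAddMonoid Γ]

/-- `X^a` is a monomial of least weight `w a` in `f`. -/
def QPoly.IsLead (w : (I → ℕ) →+ Γ) (f : QPoly B q) (a : I → ℕ) : Prop :=
  QPoly.coeff a f ≠ 0 ∧ ∀ b, QPoly.coeff b f ≠ 0 → w a ≤ w b

namespace QPoly.IsLead

variable {w : (I → ℕ) →+ Γ} {f g : QPoly B q} {a b : I → ℕ}

lemma ne_zero (h : f.IsLead w a) : f ≠ 0 := fun e => h.1 (by rw [e, map_zero])

lemma exists_of_ne_zero (hf : f ≠ 0) : ∃ a, f.IsLead w a := by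
  have : f.support.Nonempty := by
    rw [Finset.nonempty_iff_ne_empty]
    intro h
    exact hf (by rw [← QPoly.sum_monomial f, h, Finset.sum_empty])
  obtain ⟨a, ha, h⟩ := Finset.exists_min_image f.support w this
  exact ⟨a, QPoly.mem_support.1 ha, fun b hb => h b (QPoly.mem_support.2 hb)⟩

lemma monomial (a : I → ℕ) {r : 𝕜} (hr : r ≠ 0) :
    (QPoly.monomial a r : QPoly B q).IsLead w a := by
  classical
  refine ⟨by rwa [QPoly.coeff_monomial, if_pos rfl], fun b hb => ?_⟩
  rw [QPoly.coeff_monomial] at hb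
  have : a = b := by
    by_contra h
    exact hb (if_neg h)
  rw [this]

/-- As `w` is injective, only one pair of exponents attains the least weight, so the coefficient at
`a + b` is a single nonzero product and cannot cancel. -/
lemma mul (hw : Function.Injective w) (hf : f.IsLead w a) (hg : g.IsLead w b) :
    (f * g).IsLead w (a + b) := by
  classical
  refine ⟨?_, fun c hc => ?_⟩
  · have key : ∀ a' ∈ f.support, ∀ b' ∈ g.support, a' + b' = a + b → a' = a ∧ b' = b := by
      intro a' ha' b' hb' e
      have h1 := hf.2 a' (QPoly.mem_support.1 ha')
      have h2 := hg.2 b' (QPoly.mem_support.1 hb')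
      have h3 := congrArg w e
      rw [map_add, map_add] at h3
      exact ⟨hw (le_antisymm (le_of_add_le_add_right (h3.trans_le (by gcongr))) h1),
        hw (le_antisymm (le_of_add_le_add_left (h3.trans_le (by gcongr))) h2)⟩
    rw [QPoly.coeff_mul, Finset.sum_eq_single_of_mem a (QPoly.mem_support.2 hf.1),
      Finset.sum_eq_single_of_mem b (QPoly.mem_support.2 hg.1), if_pos rfl]
    · exact mul_ne_zero (mul_ne_zero hf.1 hg.1) (pow_ne_zero _ q.ne_zero)
    · intro b' hb' hne
      exact if_neg fun e => hne (key a (QPoly.mem_support.2 hf.1) b' hb' e).2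
    · intro a' ha' hne
      exact Finset.sum_eq_zero fun b' hb' => if_neg fun e => hne (key a' ha' b' hb' e).1
  · rw [QPoly.coeff_mul] at hc
    obtain ⟨a', ha', h⟩ := Finset.exists_ne_zero_of_sum_ne_zero hc
    obtain ⟨b', hb', h⟩ := Finset.exists_ne_zero_of_sum_ne_zero h
    have : a' + b' = c := by
      by_contra e
      exact h (if_neg e)
    rw [← this, map_add, map_add]
    exact add_le_add (hf.2 a' (QPoly.mem_support.1 ha')) (hg.2 b' (QPoly.mem_support.1 hb'))

lemma add_of_lt (hf : f.IsLead w a) (hg : g.IsLead w b) (h : w a < w b) : (f + g).IsLead w a := by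
  refine ⟨?_, fun c hc => ?_⟩
  · have : coeff a g = 0 := by
      by_contra e
      exact absurd (hg.2 a e) (not_le.2 h)
    rw [map_add, this, add_zero]
    exact hf.1
  · by_cases e : coeff c f = 0
    · rw [map_add, e, zero_add] at hc
      exact h.le.trans (hg.2 c hc)
    · exact hf.2 c e

end QPoly.IsLead

namespace QFrac

/-- The valuation of `z` attached to the weight `w` is `γ`. -/
def HasVal (w : (I → ℕ) →+ Γ) (z : QFrac B q) (γ : Γ) : Prop :=
  ∃ s r : QPoly B q, ∃ a b, s.IsLead w a ∧ r.IsLead w b ∧ of s * z = of r ∧ γ = w b - w a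

namespace HasVal

variable {w : (I → ℕ) →+ Γ} {z z' : QFrac B q} {γ γ' : Γ}

lemma ne_zero (h : HasVal w z γ) : z ≠ 0 := by
  obtain ⟨s, r, a, b, hs, hr, e, -⟩ := h
  rintro rfl
  rw [mul_zero] at e
  exact of_ne_zero hr.ne_zero e.symm

lemma of_isLead {f : QPoly B q} {a : I → ℕ} (h : f.IsLead w a) :
    HasVal w (of f : QFrac B q) (w a) :=
  ⟨1, f, 0, a, QPoly.IsLead.monomial 0 one_ne_zero, h, by rw [map_one, one_mul], by simp⟩

lemma of_X [DecidableEq I] (i : I) :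
    HasVal w (of (QPoly.X i) : QFrac B q) (w (Pi.single i 1)) :=
  of_isLead (QPoly.IsLead.monomial _ one_ne_zero)

lemma one : HasVal w (1 : QFrac B q) 0 := by
  have := of_isLead (B := B) (q := q) (w := w) (QPoly.IsLead.monomial 0 one_ne_zero)
  rwa [← QPoly.one_def, map_one, map_zero] at this

/-- If $sz=r$, $s'z'=r'$ and $ur=vs'$ by the Ore condition, then $(us)(zz')=vr'$. The leading
weights of $ur=vs'$ agree, which makes the values add. -/
lemma mul (hw : Function.Injective w) (h : HasVal w z γ) (h' : HasVal w z' γ') :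
    HasVal w (z * z') (γ + γ') := by
  obtain ⟨s, r, a, b, hs, hr, e, rfl⟩ := h
  obtain ⟨s', r', a', b', hs', hr', e', rfl⟩ := h'
  obtain ⟨u, v, hu, huv⟩ := QPoly.exists_ore r s' hs'.ne_zero
  have hv : v ≠ 0 := by
    rintro rfl
    rw [zero_mul] at huv
    exact mul_ne_zero hu hr.ne_zero huv
  obtain ⟨c, hc⟩ := QPoly.IsLead.exists_of_ne_zero (w := w) hu
  obtain ⟨d, hd⟩ := QPoly.IsLead.exists_of_ne_zero (w := w) hv
  have hcd : w c + w b = w d + w a' := by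
    have h1 := hc.mul hw hr
    have h2 := hd.mul hw hs'
    rw [← huv] at h2
    rw [← map_add, ← map_add]
    exact le_antisymm (h1.2 _ h2.1) (h2.2 _ h1.1)
  refine ⟨u * s, v * r', c + a, d + b', hc.mul hw hs, hd.mul hw hr', ?_, ?_⟩
  · rw [map_mul, map_mul, mul_assoc, ← mul_assoc (of s), e, ← mul_assoc, ← map_mul, huv, map_mul,
      mul_assoc, e']
  · have : w d = w c + w b - w a' := by rw [hcd, add_sub_cancel_right]
    rw [map_add, map_add, this]
    abel

lemma inv (h : HasVal w z γ) : HasVal w z⁻¹ (-γ) := by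
  have hz := h.ne_zero
  obtain ⟨s, r, a, b, hs, hr, e, rfl⟩ := h
  refine ⟨r, s, b, a, hr, hs, ?_, by abel⟩
  rw [← e, mul_assoc, mul_inv_cancel₀ hz, mul_one]

lemma div (hw : Function.Injective w) (h : HasVal w z γ) (h' : HasVal w z' γ') :
    HasVal w (z / z') (γ - γ') := by
  rw [div_eq_mul_inv, sub_eq_add_neg]
  exact h.mul hw h'.inv

lemma one_add (h : HasVal w z γ) (hγ : 0 < γ) : HasVal w (1 + z) 0 := by
  obtain ⟨s, r, a, b, hs, hr, e, rfl⟩ := h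
  refine ⟨s, s + r, a, a, hs, hs.add_of_lt hr (sub_pos.1 hγ), ?_, by abel⟩
  rw [mul_add, mul_one, e, map_add]

/-- Write $z+z'=z(1+z^{-1}z')$, where the second summand in the bracket has positive value. -/
lemma add_of_lt (hw : Function.Injective w) (h : HasVal w z γ) (h' : HasVal w z' γ')
    (hγ : γ < γ') : HasVal w (z + z') γ := by
  have := h.mul hw ((h.inv.mul hw h').one_add (by rwa [neg_add_eq_sub, sub_pos]))
  rwa [mul_add, mul_one, mul_inv_cancel_left₀ h.ne_zero, add_zero] at this

lemma smul (h : HasVal w z γ) {c : 𝕜} (hc : c ≠ 0) : HasVal w (c • z) γ := by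
  obtain ⟨s, r, a, b, hs, hr, e, rfl⟩ := h
  refine ⟨s, c • r, a, b, hs, ⟨?_, fun d hd => hr.2 d fun h0 => hd ?_⟩, ?_, rfl⟩
  · rw [map_smul]
    exact smul_ne_zero hc hr.1
  · rw [map_smul, h0, smul_zero]
  · rw [mul_smul_comm, e, map_smul]

lemma pow (hw : Function.Injective w) (h : HasVal w z γ) (n : ℕ) : HasVal w (z ^ n) (n • γ) := by
  induction n with
  | zero =>
    rw [pow_zero, zero_smul]
    exact one
  | succ n ih =>
    rw [pow_succ, succ_nsmul]
    exact ih.mul hw h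

/-- Distinct values never tie, so the smallest survives. Which one it is does not matter: having
some value already makes the sum nonzero, and uniqueness of the value is not needed. -/
lemma exists_sum (hw : Function.Injective w) {α : Type*} {u : Finset α} (hu : u.Nonempty)
    {F : α → QFrac B q} {v : α → Γ} (hF : ∀ i ∈ u, HasVal w (F i) (v i))
    (hv : Function.Injective v) : ∃ i ∈ u, HasVal w (∑ j ∈ u, F j) (v i) := by
  classical
  induction hu using Finset.Nonempty.cons_induction with
  | singleton i => exact ⟨i, by simp, by simpa using hF⟩
  | cons i u hi hu ih =>
    obtain ⟨j, hj, h⟩ := ih fun k hk => hF k (Finset.mem_cons_of_mem hk)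
    have h0 := hF i (Finset.mem_cons_self i u)
    rw [Finset.sum_cons]
    rcases lt_trichotomy (v i) (v j) with hlt | heq | hgt
    · exact ⟨i, Finset.mem_cons_self i u, h0.add_of_lt hw h hlt⟩
    · exact absurd (hv heq ▸ hj) hi
    · refine ⟨j, Finset.mem_cons_of_mem hj, ?_⟩
      rw [add_comm]
      exact h.add_of_lt hw h0 hgt

lemma orderedProd {l : List I} (hl : IsMonomialOrder B l) (hw : Function.Injective w)
    {f : I → QFrac B q} {v : I → Γ} (hf : ∀ i, HasVal w (f i) (v i)) (a : I → ℕ) :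
    HasVal w (orderedProd f l a) (∑ i, a i • v i) := by
  rw [← hl.sum_map]
  clear hl
  induction l with
  | nil => simpa [_root_.orderedProd] using one
  | cons i l ih =>
    simp only [_root_.orderedProd, List.map_cons, List.prod_cons, List.sum_cons] at ih ⊢
    exact ((hf i).pow hw _).mul hw ih

end HasVal

/-- A homomorphism is injective if the valuations of the images of the monomials are distinct. -/
lemma lift_injective {l : List I} (hl : IsMonomialOrder B l) {w : (I → ℕ) →+ Γ}
    (hw : Function.Injective w) {f : I → QFrac B q}
    (hf : ∀ i j, (q : 𝕜) ^ B j i • (f i * f j) = (q : 𝕜) ^ B i j • (f j * f i))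
    {v : I → Γ} (hv : ∀ i, HasVal w (f i) (v i))
    (hinj : Function.Injective fun a : I → ℕ => ∑ i, a i • v i) :
    Function.Injective (QPoly.lift hl f hf) := by
  rw [injective_iff_map_eq_zero]
  intro x hx
  by_contra h
  obtain ⟨a, ha⟩ := QPoly.IsLead.exists_of_ne_zero (w := w) h
  obtain ⟨b, hb, h0⟩ := HasVal.exists_sum hw ⟨a, QPoly.mem_support.2 ha.1⟩
    (F := fun a => QPoly.coeff a x • orderedProd f l a) (v := fun a => ∑ i, a i • v i)
    (fun i hi => (HasVal.orderedProd hl hw hv i).smul (QPoly.mem_support.1 hi)) hinj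
  exact h0.ne_zero (by rw [← QPoly.lift_apply hl f hf, hx])

end QFrac

end Valuation

/-! ### Ordered products with integer exponents, in a group with a central element $z$ in the role
of $q$. -/

section OrderedZPow

variable {G I : Type*} [Group G] {z : G} {f : I → G} {B : I → I → ℕ}

lemma zpow_mul_zpow_of_comm {a b : G} (hz : ∀ g, Commute z g) {c : ℤ}
    (h : a * b = z ^ c * (b * a)) (m n : ℤ) :
    a ^ m * b ^ n = z ^ (m * n * c) * (b ^ n * a ^ m) := by
  have h1 : SemiconjBy a (b ^ n) ((z ^ c * b) ^ n) :=
    SemiconjBy.zpow_right (by rw [SemiconjBy, h, mul_assoc]) n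
  rw [((hz b).zpow_left c).mul_zpow, ← zpow_mul] at h1
  have h2 : SemiconjBy (b ^ n) (a ^ m) ((z ^ (-(c * n)) * a) ^ m) := by
    refine SemiconjBy.zpow_right ?_ m
    rw [SemiconjBy, mul_assoc, h1.eq, mul_assoc, ← mul_assoc, ← zpow_add, neg_add_cancel, zpow_zero,
      one_mul]
  rw [((hz a).zpow_left _).mul_zpow, ← zpow_mul] at h2
  rw [h2.eq, ← mul_assoc, ← mul_assoc, ← zpow_add]
  ring_nf
  simp

/-- The ordered product of the `f i ^ v i`, over the list `l`. -/
def orderedZProd (f : I → G) (l : List I) (v : I → ℤ) : G := (l.map fun i => f i ^ v i).prod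

lemma orderedZProd_mul_zpow (hz : ∀ g, Commute z g)
    (hf : ∀ i j, z ^ B j i * (f i * f j) = z ^ B i j * (f j * f i))
    {i : I} {l : List I} (hl : ∀ j ∈ l, B i j = 0) (v : I → ℤ) (n : ℤ) :
    orderedZProd f l v * f i ^ n
      = z ^ (l.map fun j => v j * n * B j i).sum * (f i ^ n * orderedZProd f l v) := by
  induction l with
  | nil => simp [orderedZProd]
  | cons j l ih =>
    have ih := ih fun k hk => hl k (List.mem_cons_of_mem _ hk)
    have hj := zpow_mul_zpow_of_comm (a := f j) (b := f i) (c := B j i) hz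
      (by rw [zpow_natCast, hf, hl j List.mem_cons_self, pow_zero, one_mul]) (v j) n
    simp only [orderedZProd, List.map_cons, List.prod_cons, List.sum_cons] at ih ⊢
    rw [mul_assoc, ih, ← mul_assoc, ← ((hz (f j ^ v j)).zpow_left _).eq, mul_assoc,
      ← mul_assoc (f j ^ v j), hj, zpow_add]
    simp only [mul_assoc]
    rw [((hz _).zpow_left _).left_comm]

lemma orderedZProd_mul (hz : ∀ g, Commute z g)
    (hf : ∀ i j, z ^ B j i * (f i * f j) = z ^ B i j * (f j * f i))
    (hB : ∀ i, B i i = 0) {l : List I} (hl : l.Pairwise fun i j => B i j = 0) (v w : I → ℤ) :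
    orderedZProd f l v * orderedZProd f l w
      = z ^ (l.map fun i => (l.map fun j => v i * w j * B i j).sum).sum *
        orderedZProd f l (v + w) := by
  induction l with
  | nil => simp [orderedZProd]
  | cons i l ih =>
    rw [List.pairwise_cons] at hl
    have ih := ih hl.2
    have hi := orderedZProd_mul_zpow hz hf hl.1 v (w i)
    have h0 : (l.map fun j => v i * w j * B i j).sum = 0 :=
      List.sum_eq_zero fun x hx => by
        obtain ⟨j, hj, rfl⟩ := List.mem_map.1 hx
        rw [hl.1 j hj, Nat.cast_zero, mul_zero]
    simp only [orderedZProd, List.map_cons, List.prod_cons, List.sum_cons, hB, Nat.cast_zero,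
      mul_zero, h0, zero_add, Pi.add_apply, List.sum_map_add] at ih hi ⊢
    rw [mul_assoc, ← mul_assoc _ (f i ^ w i), hi, mul_assoc, mul_assoc, ih,
      ((hz (f i ^ w i)).symm.zpow_right _).left_comm, ((hz (f i ^ v i)).symm.zpow_right _).left_comm,
      ((hz (f i ^ v i)).symm.zpow_right _).left_comm]
    simp only [mul_assoc, zpow_add]

end OrderedZPow

/-! ### Laurent monomials in the generators, and a decision procedure for sums of them. -/

/-- The generators, enumerated so that `qWeight g g' = 0` if `g` is not after `g'`. -/
def genList : List Gen :=
  [.x, .y, .h 1, .h 2, .σ 1, .σ 2] ++ (List.finRange 11).map .τ ++ (List.finRange 11).map .e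

lemma genList_isMonomialOrder : IsMonomialOrder qWeight genList where
  nodup := by decide +kernel
  mem := by decide +kernel
  diag := by decide +kernel
  pairwise := by decide +kernel

/-- Exponents of the Laurent monomials in the generators. -/
abbrev GenExp := Gen → ℤ

/-- The exponent of `q` produced when two Laurent monomials are multiplied. -/
def qForm (v w : GenExp) : ℤ :=
  v .y * w .x + (v (.σ 1) * w (.h 2) + v (.σ 2) * w (.h 1)) +
    ((List.finRange 11).map fun i => v (.e i) * w (.τ i)).sum

lemma qForm_eq (v w : GenExp) :
    (genList.map fun i => (genList.map fun j => v i * w j * qWeight i j).sum).sum = qForm v w := by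
  simp only [genList, List.map_append, List.sum_append, List.map_cons, List.map_nil, List.sum_cons,
    List.sum_nil, List.map_map, Function.comp_def, qForm, ← Fin.sum_univ_def]
  simp [qWeight]

/-- The exponent of the generator `g`. -/
def genExp (g g' : Gen) : ℤ :=
  if g = g' then 1 else 0

section Monomials

variable {𝕜 : Type*} [Field 𝕜] {q : 𝕜ˣ}

lemma gen_eq_of (g : Gen) : gen q g = QFrac.of (QPoly.X g) := rfl

lemma gen_ne_zero (g : Gen) : gen q g ≠ 0 :=
  QFrac.of_ne_zero (QPoly.IsLead.monomial (w := (0 : (Gen → ℕ) →+ ℤ)) _ one_ne_zero).ne_zero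

/-- The generators, as units. -/
noncomputable def genUnit (q : 𝕜ˣ) (g : Gen) : (SkewK q)ˣ := Units.mk0 (gen q g) (gen_ne_zero g)

/-- The central unit `q`. -/
noncomputable def qUnit (q : 𝕜ˣ) : (SkewK q)ˣ := Units.map (algebraMap 𝕜 (SkewK q)) q

lemma qUnit_commute (u : (SkewK q)ˣ) : Commute (qUnit q) u :=
  Units.ext (Algebra.commutes (q : 𝕜) (u : SkewK q))

lemma coe_qUnit_zpow (n : ℤ) : ((qUnit q ^ n : (SkewK q)ˣ) : SkewK q)
    = algebraMap 𝕜 (SkewK q) ((q ^ n : 𝕜ˣ) : 𝕜) := by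
  rw [qUnit, ← map_zpow]
  rfl

lemma genUnit_mul_genUnit (g g' : Gen) :
    qUnit q ^ qWeight g' g * (genUnit q g * genUnit q g')
      = qUnit q ^ qWeight g g' * (genUnit q g' * genUnit q g) := by
  ext
  have := gen_mul_gen q g g'
  simp only [Algebra.smul_def, map_pow] at this
  simpa [genUnit, qUnit] using this

/-- The Laurent monomials in the generators. -/
noncomputable def laurent (q : 𝕜ˣ) (v : GenExp) : (SkewK q)ˣ :=
  orderedZProd (genUnit q) genList v

lemma laurent_mul (v w : GenExp) :
    laurent q v * laurent q w = qUnit q ^ qForm v w * laurent q (v + w) := by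
  rw [laurent, laurent, orderedZProd_mul qUnit_commute genUnit_mul_genUnit
    genList_isMonomialOrder.diag genList_isMonomialOrder.pairwise, qForm_eq, laurent]

lemma laurent_zero : laurent q 0 = 1 :=
  List.prod_eq_one fun x hx => by
    obtain ⟨j, -, rfl⟩ := List.mem_map.1 hx
    simp

lemma laurent_genExp (g : Gen) : laurent q (genExp g) = genUnit q g := by
  have h : ∀ l : List Gen, l.Nodup →
      orderedZProd (genUnit q) l (genExp g) = if g ∈ l then genUnit q g else 1 := by
    intro l hl
    induction l with
    | nil => simp [orderedZProd]
    | cons j l ih =>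
      rw [List.nodup_cons] at hl
      have ih := ih hl.2
      simp only [orderedZProd, List.map_cons, List.prod_cons] at ih ⊢
      rw [ih]
      by_cases hij : g = j
      · subst hij
        simp [hl.1, genExp]
      · simp [hij, genExp]
  rw [laurent, h _ genList_isMonomialOrder.nodup, if_pos (genList_isMonomialOrder.mem g)]

/-- The term `q^n X^v`. -/
noncomputable def term (q : 𝕜ˣ) (n : ℤ) (v : GenExp) : (SkewK q)ˣ := qUnit q ^ n * laurent q v

lemma term_mul (n m : ℤ) (v w : GenExp) :
    term q n v * term q m w = term q (n + m + qForm v w) (v + w) := by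
  rw [term, term, mul_assoc, ((qUnit_commute (laurent q v)).symm.zpow_right m).left_comm,
    laurent_mul, term, zpow_add, zpow_add]
  simp only [mul_assoc]

lemma qForm_neg_right (v w : GenExp) : qForm v (-w) = - qForm v w := by
  simp only [qForm, ← Fin.sum_univ_def, Pi.neg_apply, mul_neg, Finset.sum_neg_distrib]
  ring

lemma term_inv (n : ℤ) (v : GenExp) : (term q n v)⁻¹ = term q (-n + qForm v v) (-v) := by
  rw [inv_eq_iff_mul_eq_one, term_mul, qForm_neg_right, add_neg_cancel, add_neg_cancel_left,
    add_neg_cancel, term, zpow_zero, laurent_zero, one_mul]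

/-- `x` is the term `q^n X^v`. -/
class IsTerm (x : SkewK q) (n : outParam ℤ) (v : outParam GenExp) : Prop where
  eq : x = term q n v

/-- `x` is the sum of the terms `q^n X^v`, over the entries `(n, v)` of the list `p`. -/
class IsSumTerms (x : SkewK q) (p : outParam (List (ℤ × GenExp))) : Prop where
  eq : x = (p.map fun t => (term q t.1 t.2 : SkewK q)).sum

/-- These instances form an evaluator: instance search follows the shape of an expression and
returns its exponents as output parameters, which the kernel can then compute. -/
instance (g : Gen) : IsTerm (gen q g) 0 (genExp g) :=
  ⟨by rw [term, zpow_zero, one_mul, laurent_genExp]; rfl⟩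

instance : IsTerm (1 : SkewK q) 0 0 :=
  ⟨by rw [term, zpow_zero, one_mul, laurent_zero, Units.val_one]⟩

instance (x y : SkewK q) (n m : ℤ) (v w : GenExp) [hx : IsTerm x n v] [hy : IsTerm y m w] :
    IsTerm (x * y) (n + m + qForm v w) (v + w) :=
  ⟨by rw [hx.eq, hy.eq, ← Units.val_mul, term_mul]⟩

instance (x : SkewK q) (n : ℤ) (v : GenExp) [hx : IsTerm x n v] :
    IsTerm x⁻¹ (-n + qForm v v) (-v) :=
  ⟨by rw [hx.eq, ← Units.val_inv_eq_inv_val, term_inv]⟩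

instance (x y : SkewK q) (n m : ℤ) (v w : GenExp) [IsTerm x n v] [IsTerm y m w] :
    IsTerm (x / y) (n + (-m + qForm w w) + qForm v (-w)) (v + -w) :=
  ⟨by rw [div_eq_mul_inv]; exact IsTerm.eq⟩

/-- Tried first, so that a monomial subexpression is kept as a single term instead of being expanded
as a product of sums. -/
instance (priority := 2000) (x : SkewK q) (n : ℤ) (v : GenExp) [hx : IsTerm x n v] :
    IsSumTerms x [(n, v)] :=
  ⟨by rw [List.map_singleton, List.sum_singleton]; exact hx.eq⟩

instance (x y : SkewK q) (l l' : List (ℤ × GenExp)) [hx : IsSumTerms x l] [hy : IsSumTerms y l'] :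
    IsSumTerms (x + y) (l ++ l') :=
  ⟨by rw [List.map_append, List.sum_append, ← hx.eq, ← hy.eq]⟩

/-- The list of the products of the terms of two lists. -/
def mulTerms (l l' : List (ℤ × GenExp)) : List (ℤ × GenExp) :=
  l.flatMap fun t => l'.map fun t' => (t.1 + t'.1 + qForm t.2 t'.2, t.2 + t'.2)

instance (x y : SkewK q) (l l' : List (ℤ × GenExp)) [hx : IsSumTerms x l] [hy : IsSumTerms y l'] :
    IsSumTerms (x * y) (mulTerms l l') :=
  ⟨by
    rw [hx.eq, hy.eq]
    clear hx hy
    induction l with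
    | nil => simp [mulTerms]
    | cons t l ih =>
      simp only [mulTerms, List.flatMap_cons, List.map_append, List.sum_append, List.map_cons,
        List.sum_cons, add_mul, List.map_map] at ih ⊢
      rw [ih, ← List.sum_map_mul_left]
      simp only [Function.comp_def, ← Units.val_mul, term_mul]⟩

instance (x y : SkewK q) (l : List (ℤ × GenExp)) (m : ℤ) (w : GenExp) [IsSumTerms x l]
    [IsTerm y m w] : IsSumTerms (x / y) (mulTerms l [(-m + qForm w w, -w)]) :=
  ⟨by rw [div_eq_mul_inv]; exact IsSumTerms.eq⟩

/-- The exponents of a term, as a list of integers. -/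
def termKey (t : ℤ × GenExp) : List ℤ := t.1 :: genList.map t.2

/-- Equality of exponent functions is replaced by equality of lists of integers, for which being a
permutation is decidable by evaluation. -/
lemma termKey_injective : Function.Injective termKey := by
  intro t t' h
  rw [termKey, termKey, List.cons.injEq, List.map_inj_left] at h
  exact Prod.ext h.1 (funext fun g => h.2 g (genList_isMonomialOrder.mem g))

/-- Two sums of Laurent monomials with the same terms are equal. -/
lemma eq_of_terms {x y : SkewK q} {l l' : List (ℤ × GenExp)} [hx : IsSumTerms x l]
    [hy : IsSumTerms y l'] (h : (l.map termKey).Perm (l'.map termKey)) : x = y := by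
  have := h.map (Function.invFun termKey)
  rw [List.map_map, List.map_map, Function.invFun_comp termKey_injective, List.map_id,
    List.map_id] at this
  rw [hx.eq, hy.eq]
  exact (this.map _).sum_eq

end Monomials

/-! ### $q$-commutation, the lexicographic valuation, and the existence criterion for endomorphisms.
-/

section Action

variable {𝕜 : Type*} [Field 𝕜] {q : 𝕜ˣ}

/-- The exponent of `q` produced when two Laurent monomials are exchanged. -/
def qComm (v w : GenExp) : ℤ := qForm v w - qForm w v

/-- The relation `x * y = q^c * (y * x)`. -/
def QCommute (c : ℤ) (x y : SkewK q) : Prop :=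
  x * y = (qUnit q ^ c : (SkewK q)ˣ) * (y * x)

lemma coe_qUnit_commute (c : ℤ) (x : SkewK q) :
    Commute ((qUnit q ^ c : (SkewK q)ˣ) : SkewK q) x := by
  rw [coe_qUnit_zpow]
  exact Algebra.commutes _ _

namespace QCommute

variable {x y z : SkewK q} {c d : ℤ}

lemma _root_.Commute.qCommute (h : Commute x y) : QCommute 0 x y := by
  rw [QCommute, zpow_zero, Units.val_one, one_mul, h.eq]

lemma commute (h : QCommute 0 x y) : Commute x y := by
  rwa [QCommute, zpow_zero, Units.val_one, one_mul] at h

lemma symm (h : QCommute c x y) : QCommute (-c) y x := by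
  rw [QCommute] at h ⊢
  rw [h, ← mul_assoc, ← Units.val_mul, ← zpow_add, neg_add_cancel, zpow_zero, Units.val_one,
    one_mul]

lemma mul_right (h : QCommute c x y) (h' : QCommute d x z) : QCommute (c + d) x (y * z) := by
  rw [QCommute] at h h' ⊢
  rw [← mul_assoc, h, mul_assoc, mul_assoc, h', (coe_qUnit_commute d y).symm.left_comm, zpow_add,
    Units.val_mul, mul_assoc, mul_assoc]

lemma mul_left (h : QCommute c x z) (h' : QCommute d y z) : QCommute (c + d) (x * y) z := by
  have := (h.symm.mul_right h'.symm).symm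
  rwa [neg_add, neg_neg, neg_neg] at this

lemma inv_right (h : QCommute c x y) : QCommute (-c) x y⁻¹ := by
  by_cases hy : y = 0
  · simp [QCommute, hy]
  · have h' := h.symm
    rw [QCommute] at h' ⊢
    apply mul_left_cancel₀ hy
    apply mul_right_cancel₀ hy
    rw [mul_assoc, mul_assoc, inv_mul_cancel₀ hy, mul_one, h',
      (coe_qUnit_commute _ y).symm.left_comm, mul_inv_cancel_left₀ hy, mul_assoc]

lemma div_right (h : QCommute c x y) (h' : QCommute d x z) : QCommute (c - d) x (y / z) := by
  rw [div_eq_mul_inv, sub_eq_add_neg]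
  exact h.mul_right h'.inv_right

lemma div_left (h : QCommute c x z) (h' : QCommute d y z) : QCommute (c - d) (x / y) z := by
  have := (h.symm.div_right h'.symm).symm
  rwa [show -(-c - -d) = c - d by ring] at this

lemma congr (h : QCommute c x y) (hcd : c = d) : QCommute d x y := hcd ▸ h

/-- Two terms $q$-commute with exponent given by the skew form; if this exponent is the same for all
pairs of terms, it passes to the sums by bilinearity. -/
lemma of_terms {l l' : List (ℤ × GenExp)} [hx : IsSumTerms x l] [hy : IsSumTerms y l']
    (h : ∀ t ∈ l, ∀ t' ∈ l', qComm t.2 t'.2 = c) : QCommute c x y := by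
  have key : ∀ t t' : ℤ × GenExp, QCommute (qComm t.2 t'.2) (term q t.1 t.2 : SkewK q)
      (term q t'.1 t'.2) := by
    intro t t'
    have : term q t.1 t.2 * term q t'.1 t'.2
        = qUnit q ^ qComm t.2 t'.2 * (term q t'.1 t'.2 * term q t.1 t.2) := by
      rw [term_mul, term_mul, term, term, ← mul_assoc, ← zpow_add, qComm, add_comm t'.2]
      congr 2
      ring
    rw [QCommute]
    simpa only [Units.val_mul] using congrArg Units.val this
  have zero_right : ∀ x : SkewK q, QCommute c x 0 := fun x => by simp [QCommute]
  have add_right : ∀ x y z : SkewK q, QCommute c x y → QCommute c x z → QCommute c x (y + z) := by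
    intro x y z h h'
    rw [QCommute] at h h' ⊢
    rw [mul_add, add_mul, mul_add, h, h']
  have h1 : ∀ t ∈ l, QCommute c (term q t.1 t.2 : SkewK q) y := by
    intro t ht
    rw [hy.eq]
    clear hy
    induction l' with
    | nil => exact zero_right _
    | cons t' l' ih =>
      rw [List.map_cons, List.sum_cons]
      exact add_right _ _ _ ((key t t').congr (h t ht t' List.mem_cons_self))
        (ih fun s hs s' hs' => h s hs s' (List.mem_cons_of_mem _ hs'))
  rw [hx.eq]
  clear hx h hy
  induction l with
  | nil => simp [QCommute]
  | cons t l ih =>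
    rw [List.map_cons, List.sum_cons]
    have h2 := h1 t List.mem_cons_self
    have h3 := ih fun s hs => h1 s (List.mem_cons_of_mem _ hs)
    rw [QCommute] at h2 h3 ⊢
    rw [add_mul, mul_add, mul_add, h2, h3]

lemma smul_mul_eq {a b : ℕ} (h : QCommute ((a : ℤ) - b) x y) :
    (q : 𝕜) ^ b • (x * y) = (q : 𝕜) ^ a • (y * x) := by
  rw [QCommute, coe_qUnit_zpow, ← Algebra.smul_def] at h
  rw [h, smul_smul, ← Units.val_pow_eq_pow_val, ← Units.val_pow_eq_pow_val, ← Units.val_mul,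
    ← zpow_natCast, ← zpow_natCast, ← zpow_add]
  congr 3
  ring

end QCommute

/-- The exponents, ordered lexicographically. -/
def genWeight : GenExp →+ Lex (Fin genList.length → ℤ) where
  toFun v := toLex fun k => v (genList.get k)
  map_zero' := rfl
  map_add' _ _ := rfl

/-- The exponents of the monomials, ordered lexicographically. -/
def genWeightNat : (Gen → ℕ) →+ Lex (Fin genList.length → ℤ) :=
  genWeight.comp
    { toFun := fun a g => (a g : ℤ)
      map_zero' := rfl
      map_add' := fun a b => funext fun g => Nat.cast_add (a g) (b g) }

lemma genWeight_injective : Function.Injective genWeight := by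
  intro v w h
  funext g
  obtain ⟨k, rfl⟩ := List.get_of_mem (genList_isMonomialOrder.mem g)
  exact congrFun (toLex.injective h) k

lemma genWeightNat_injective : Function.Injective genWeightNat :=
  genWeight_injective.comp fun _ _ h => funext fun g => Nat.cast_injective (congrFun h g)

lemma genWeight_pos {v : GenExp}
    (h : ∃ k, (∀ j < k, v (genList.get j) = 0) ∧ 0 < v (genList.get k)) : 0 < genWeight v := by
  obtain ⟨k, h1, h2⟩ := h
  exact ⟨k, fun j hj => (h1 j hj).symm, h2⟩

/-- The valuation of `x` is given by the exponent `v`. -/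
abbrev HasExp (x : SkewK q) (v : GenExp) : Prop := QFrac.HasVal genWeightNat x (genWeight v)

lemma HasExp.one : HasExp (1 : SkewK q) 0 := by
  have := QFrac.HasVal.one (B := qWeight) (q := q) (w := genWeightNat)
  rwa [← map_zero genWeight] at this

lemma HasExp.mul {x y : SkewK q} {v w : GenExp} (hx : HasExp x v) (hy : HasExp y w) :
    HasExp (x * y) (v + w) := by
  have := QFrac.HasVal.mul genWeightNat_injective hx hy
  rwa [← map_add] at this

lemma HasExp.div {x y : SkewK q} {v w : GenExp} (hx : HasExp x v) (hy : HasExp y w) :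
    HasExp (x / y) (v - w) := by
  have := QFrac.HasVal.div genWeightNat_injective hx hy
  rwa [← map_sub] at this

lemma hasExp_genUnit (g : Gen) : HasExp (genUnit q g : SkewK q) (genExp g) := by
  have := QFrac.HasVal.of_X (B := qWeight) (q := q) (w := genWeightNat) g
  have e : genWeightNat (Pi.single g 1) = genWeight (genExp g) :=
    congrArg genWeight (funext fun g' => by simp [genExp, Pi.single_apply, eq_comm])
  rw [e] at this
  exact this

lemma hasExp_genUnit_zpow (g : Gen) (n : ℤ) :
    HasExp ((genUnit q g ^ n : (SkewK q)ˣ) : SkewK q) (n • genExp g) := by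
  have h := QFrac.HasVal.pow genWeightNat_injective (hasExp_genUnit (q := q) g)
  cases n with
  | ofNat n =>
    have := h n
    rw [← map_nsmul, ← Units.val_pow_eq_pow_val] at this
    simpa using this
  | negSucc n =>
    have := (h (n + 1)).inv
    rw [← map_nsmul, ← map_neg, ← Units.val_pow_eq_pow_val, ← Units.val_inv_eq_inv_val] at this
    rw [zpow_negSucc, negSucc_zsmul]
    exact this

lemma hasExp_laurent (v : GenExp) : HasExp (laurent q v : SkewK q) v := by
  have h : ∀ l : List Gen, HasExp ((orderedZProd (genUnit q) l v : (SkewK q)ˣ) : SkewK q)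
      (l.map fun g => v g • genExp g).sum := by
    intro l
    induction l with
    | nil =>
      exact HasExp.one
    | cons g l ih =>
      simp only [orderedZProd, List.map_cons, List.prod_cons, List.sum_cons, Units.val_mul] at ih ⊢
      exact (hasExp_genUnit_zpow g _).mul ih
  have := h genList
  rw [genList_isMonomialOrder.sum_map] at this
  have e : ∑ g, v g • genExp g = v := funext fun g => by simp [Finset.sum_apply, genExp]
  rw [e] at this
  exact this

lemma HasExp.of_isTerm {x : SkewK q} {n : ℤ} {v : GenExp} [hx : IsTerm x n v] : HasExp x v := by
  have := (hasExp_laurent (q := q) v).smul (q ^ n : 𝕜ˣ).ne_zero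
  rw [Algebra.smul_def, ← coe_qUnit_zpow, ← Units.val_mul] at this
  rw [hx.eq]
  exact this

/-- The hypothesis asks that the first nonzero exponent be positive. As $x$ and $y$ head `genList`,
it holds for $y$ or $x$ times any monomial in the $h_i$ and $e_i$, whatever the signs of the later
exponents. -/
lemma HasExp.one_add {x : SkewK q} {n : ℤ} {v : GenExp} [IsTerm x n v]
    (h : ∃ k, (∀ j < k, v (genList.get j) = 0) ∧ 0 < v (genList.get k)) : HasExp (1 + x) 0 := by
  have := QFrac.HasVal.one_add (HasExp.of_isTerm (x := x)) (genWeight_pos h)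
  rwa [← map_zero genWeight] at this

/-- `φ` acts on the generators by `f`. -/
def ActsBy (φ : SkewK q →ₐ[𝕜] SkewK q) (f : Gen → SkewK q) : Prop := ∀ g, φ (gen q g) = f g

/-- Elements which satisfy the defining relations, and whose valuations form a basis, are the
images of the generators under an endomorphism. -/
lemma exists_actsBy {f : Gen → SkewK q} {T : Gen → GenExp} (T' : Gen → GenExp)
    (hrel : ∀ i j, QCommute ((qWeight i j : ℤ) - qWeight j i) (f i) (f j))
    (hval : ∀ i, HasExp (f i) (T i))
    (hT : ∀ i j, (genList.map fun k => T i k * T' k j).sum = genExp i j) :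
    ∃ φ : SkewK q →ₐ[𝕜] SkewK q, ActsBy φ f := by
  -- The value of the image of $X^a$ is the row vector $aT$, and $TT'=1$ recovers $a$ from it.
  have hinj : Function.Injective fun a : Gen → ℕ => ∑ i, a i • genWeight (T i) := by
    intro a b h
    have h1 : ∀ a : Gen → ℕ, ∑ i, a i • genWeight (T i)
        = genWeight (fun k => ∑ i, (a i : ℤ) * T i k) := fun a => by
      simp only [← map_nsmul, ← map_sum]
      refine congrArg genWeight (funext fun k => ?_)
      simp
    have h2 : ∀ (a : Gen → ℕ) (j), ∑ k, (∑ i, (a i : ℤ) * T i k) * T' k j = a j := fun a j => by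
      simp only [Finset.sum_mul, mul_assoc]
      rw [Finset.sum_comm]
      have hT' : ∀ i j, ∑ k, T i k * T' k j = genExp i j := fun i j => by
        rw [← hT, genList_isMonomialOrder.sum_map]
      simp only [← Finset.mul_sum, hT']
      simp [genExp]
    simp only [h1] at h
    have h3 := genWeight_injective h
    funext j
    have h4 := h2 a j
    have h5 := h2 b j
    simp only [fun k => congrFun h3 k] at h4
    exact_mod_cast h4.symm.trans h5
  refine ⟨QFrac.lift (QPoly.lift genList_isMonomialOrder f fun i j => (hrel i j).smul_mul_eq)
    (QFrac.lift_injective genList_isMonomialOrder genWeightNat_injective _ hval hinj), fun g => ?_⟩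
  rw [gen_eq_of, QFrac.lift_of, QPoly.lift_X]

end Action

/-! ### Existence of the endomorphisms attached to $s_0$, $s_3$ and the permutations of the indices.
-/

section Endomorphisms

variable {𝕜 : Type*} [Field 𝕜] {q : 𝕜ˣ}

lemma QCommute.of_isTerm {x y : SkewK q} {n m : ℤ} {v w : GenExp} [IsTerm x n v] [IsTerm y m w]
    {c : ℤ} (h : qComm v w = c) : QCommute c x y :=
  QCommute.of_terms fun t ht t' ht' => by
    rw [List.mem_singleton.1 ht, List.mem_singleton.1 ht', h]

lemma QCommute.one_add {x y : SkewK q} {n m : ℤ} {v w : GenExp} [IsTerm x n v] [IsTerm y m w]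
    (h : qComm v w = 0) : QCommute 0 (1 + x) y := by
  have h1 := (QCommute.of_isTerm (x := x) (y := y) h).commute
  exact ((Commute.one_left y).add_left h1).qCommute

/-- `S` will hold the generators whose images contain a sum factor. By antisymmetry each unordered
pair needs checking only once, and pairs outside `S` involve monomials only. -/
lemma qCommute_of_special {f : Gen → SkewK q} (S : List Gen)
    (h1 : ∀ i ∉ S, ∀ j ∉ S, QCommute ((qWeight i j : ℤ) - qWeight j i) (f i) (f j))
    (h2 : ∀ i ∈ S, ∀ j ∉ S, QCommute ((qWeight i j : ℤ) - qWeight j i) (f i) (f j))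
    (h3 : S.Pairwise fun i j => QCommute ((qWeight i j : ℤ) - qWeight j i) (f i) (f j)) (i j : Gen) :
    QCommute ((qWeight i j : ℤ) - qWeight j i) (f i) (f j) := by
  by_cases hi : i ∈ S
  · by_cases hj : j ∈ S
    · have : Std.Symm fun i j =>
          QCommute ((qWeight i j : ℤ) - qWeight j i) (f i) (f j) :=
        ⟨fun _ _ h => h.symm.congr (by ring)⟩
      refine List.Pairwise.forall_of_forall (fun a _ => ?_) h3 hi hj
      rw [sub_self]
      exact (Commute.refl _).qCommute
    · exact h2 i hi j hj
  · by_cases hj : j ∈ S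
    · exact (h2 j hj i hi).symm.congr (by ring)
    · exact h1 i hi j hj

/-- The exponents of the values of `s₀` on the generators. -/
def s₀Exp (g : Gen) : GenExp :=
  if g = .e 10 then genExp (.h 2) - genExp (.e 11)
  else if g = .e 11 then genExp (.h 2) - genExp (.e 10)
  else if g = .h 1 then (genExp (.h 1) + genExp (.h 2)) - (genExp (.e 10) + genExp (.e 11))
  else if g = .x then genExp .x
  else if g = .τ 10 then genExp (.σ 2) - genExp (.τ 11)
  else if g = .τ 11 then genExp (.σ 2) - genExp (.τ 10)
  else if g = .σ 1 then (genExp (.σ 1) + genExp (.σ 2)) - (genExp (.τ 10) + genExp (.τ 11))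
  else genExp g

/-- The exponents of the values of `s₃` on the generators. -/
def s₃Exp (g : Gen) : GenExp :=
  if g = .e 1 then genExp (.h 1) - genExp (.e 7)
  else if g = .e 7 then genExp (.h 1) - genExp (.e 1)
  else if g = .h 2 then (genExp (.h 1) + genExp (.h 2)) - (genExp (.e 1) + genExp (.e 7))
  else if g = .y then genExp .y
  else if g = .τ 1 then genExp (.σ 1) - genExp (.τ 7)
  else if g = .τ 7 then genExp (.σ 1) - genExp (.τ 1)
  else if g = .σ 2 then (genExp (.σ 1) + genExp (.σ 2)) - (genExp (.τ 1) + genExp (.τ 7))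
  else genExp g

/-- This makes the exponent matrix its own inverse, so it serves as both `T` and `T'` in
`exists_actsBy`. -/
lemma s₀Exp_involutive : ∀ i ∈ genList, ∀ j ∈ genList,
    (genList.map fun k => s₀Exp i k * s₀Exp k j).sum = genExp i j := by
  decide +kernel

lemma qComm_s₀Exp : ∀ i ∈ genList, ∀ j ∈ genList,
    qComm (s₀Exp i) (s₀Exp j) = (qWeight i j : ℤ) - qWeight j i := by
  decide +kernel

lemma s₃Exp_involutive : ∀ i ∈ genList, ∀ j ∈ genList,
    (genList.map fun k => s₃Exp i k * s₃Exp k j).sum = genExp i j := by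
  decide +kernel

lemma qComm_s₃Exp : ∀ i ∈ genList, ∀ j ∈ genList,
    qComm (s₃Exp i) (s₃Exp j) = (qWeight i j : ℤ) - qWeight j i := by
  decide +kernel

lemma s₀Image_isTerm {g : Gen} (hg : g ∉ [.x, .τ 10, .τ 11, .σ 1]) :
    ∃ n, IsTerm (s₀Image q g) n (s₀Exp g) := by
  simp only [List.mem_cons, List.not_mem_nil, or_false, not_or] at hg
  unfold s₀Image s₀Exp
  dsimp only
  simp only [hg, if_false, sub_eq_add_neg]
  split_ifs
  all_goals exact ⟨_, inferInstance⟩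

lemma s₃Image_isTerm {g : Gen} (hg : g ∉ [.y, .τ 1, .τ 7, .σ 2]) :
    ∃ n, IsTerm (s₃Image q g) n (s₃Exp g) := by
  simp only [List.mem_cons, List.not_mem_nil, or_false, not_or] at hg
  unfold s₃Image s₃Exp
  dsimp only
  simp only [hg, if_false, sub_eq_add_neg]
  split_ifs
  all_goals exact ⟨_, inferInstance⟩

/-- The factors $F$ and $G$ have value $0$, so only the monomial part of each image is seen. -/
lemma hasExp_s₀Image (g : Gen) : HasExp (s₀Image q g) (s₀Exp g) := by
  have hF : HasExp (1 + gen q .y * (gen q (.h 2) / gen q (.e 10))) 0 :=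
    HasExp.one_add (by decide +kernel)
  have hG : HasExp (1 + gen q .y * gen q (.e 11)) 0 := HasExp.one_add (by decide +kernel)
  have hg := fun g => HasExp.of_isTerm (x := gen q g)
  unfold s₀Image s₀Exp
  dsimp only
  split_ifs
  · exact (hg _).div (hg _)
  · exact (hg _).div (hg _)
  · exact ((hg _).mul (hg _)).div ((hg _).mul (hg _))
  · simpa using (hg _).mul (hF.div hG)
  · simpa using hG.mul ((hg (.σ 2)).div (hg (.τ 11)))
  · simpa using ((hg (.σ 2)).div (hg (.τ 10))).mul hF
  · simpa using hG.mul (((hg (.σ 1)).mul (hg (.σ 2))).div ((hg (.τ 10)).mul (hg (.τ 11))))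
  · exact hg _

lemma hasExp_s₃Image (g : Gen) : HasExp (s₃Image q g) (s₃Exp g) := by
  have hP : HasExp (1 + gen q .x * (gen q (.e 7) / gen q (.h 1))) 0 :=
    HasExp.one_add (by decide +kernel)
  have hQ : HasExp (1 + gen q .x / gen q (.e 1)) 0 := HasExp.one_add (by decide +kernel)
  have hg := fun g => HasExp.of_isTerm (x := gen q g)
  unfold s₃Image s₃Exp
  dsimp only
  split_ifs
  · exact (hg _).div (hg _)
  · exact (hg _).div (hg _)
  · exact ((hg _).mul (hg _)).div ((hg _).mul (hg _))
  · simpa using (hP.div hQ).mul (hg _)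
  · simpa using hP.mul ((hg (.σ 1)).div (hg (.τ 7)))
  · simpa using ((hg (.σ 1)).div (hg (.τ 1))).mul hQ
  · simpa using (((hg (.σ 1)).mul (hg (.σ 2))).div ((hg (.τ 1)).mul (hg (.τ 7)))).mul hQ
  · exact hg _

/-! The two shapes of the relations between `x ↦ x (F / G)` and `t ↦ G m` or `t ↦ m F`. -/

lemma commute_mul_div_mul_left {A : Type*} [DivisionRing A] {x F G m : A} (hG : G ≠ 0)
    (hFG : Commute F G) (hFm : Commute F m) (hxm : Commute x m) (h : Commute G (m * x)) :
    Commute (x * (F / G)) (G * m) := by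
  have h1 : F / G = G⁻¹ * F := by rw [div_eq_mul_inv, hFG.inv_right₀.eq]
  calc x * (F / G) * (G * m) = x * (F * (G⁻¹ * G)) * m := by rw [div_eq_mul_inv]; noncomm_ring
    _ = m * x * F := by rw [inv_mul_cancel₀ hG, mul_one, mul_assoc, hFm.eq, ← mul_assoc, hxm.eq]
    _ = m * x * (G * G⁻¹) * F := by rw [mul_inv_cancel₀ hG, mul_one]
    _ = (m * x * G) * (F / G) := by rw [h1]; noncomm_ring
    _ = G * m * (x * (F / G)) := by rw [← h.eq]; noncomm_ring

lemma commute_mul_div_mul_right {A : Type*} [DivisionRing A] {x F G m : A}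
    (hFG : Commute F G) (hGm : Commute G m) (h : x * F * m = m * F * x) :
    Commute (x * (F / G)) (m * F) := by
  have h1 : Commute (m * F) G⁻¹ := (hGm.symm.mul_left hFG).inv_right₀
  calc x * (F / G) * (m * F) = x * F * (G⁻¹ * (m * F)) := by rw [div_eq_mul_inv]; noncomm_ring
    _ = x * F * m * F * G⁻¹ := by rw [← h1.eq]; noncomm_ring
    _ = m * F * (x * (F / G)) := by rw [h, div_eq_mul_inv]; noncomm_ring

lemma commute_div_mul_mul_left {A : Type*} [DivisionRing A] {y P Q n : A}
    (hPQ : Commute P Q) (hQn : Commute Q n) (h : y * P * n = n * P * y) :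
    Commute (P / Q * y) (P * n) := by
  have h1 : Commute (P * n) Q⁻¹ := (hPQ.mul_left hQn.symm).inv_right₀
  have h2 : P / Q = Q⁻¹ * P := by rw [div_eq_mul_inv, hPQ.inv_right₀.eq]
  calc P / Q * y * (P * n) = Q⁻¹ * (P * (y * P * n)) := by rw [h2]; noncomm_ring
    _ = (Q⁻¹ * (P * n)) * (P * y) := by rw [h]; noncomm_ring
    _ = P * n * (P / Q * y) := by rw [← h1.eq, h2]; noncomm_ring

lemma commute_div_mul_mul_right {A : Type*} [DivisionRing A] {y P Q n : A} (hQ : Q ≠ 0)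
    (hPQ : Commute P Q) (hPn : Commute P n) (hyn : Commute y n) (h : Commute (y * n) Q) :
    Commute (P / Q * y) (n * Q) := by
  have h2 : P / Q = Q⁻¹ * P := by rw [div_eq_mul_inv, hPQ.inv_right₀.eq]
  calc P / Q * y * (n * Q) = P / Q * (y * n * Q) := by noncomm_ring
    _ = P * (Q⁻¹ * Q) * (y * n) := by rw [h.eq, div_eq_mul_inv]; noncomm_ring
    _ = P * n * y := by rw [inv_mul_cancel₀ hQ, hyn.eq]; noncomm_ring
    _ = n * (Q * Q⁻¹) * P * y := by rw [mul_inv_cancel₀ hQ, hPn.eq]; noncomm_ring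
    _ = n * Q * (P / Q * y) := by rw [h2]; noncomm_ring

lemma qCommute_s₀Image (i j : Gen) :
    QCommute ((qWeight i j : ℤ) - qWeight j i) (s₀Image q i) (s₀Image q j) := by
  have hF0 : 1 + gen q .y * (gen q (.h 2) / gen q (.e 10)) ≠ 0 :=
    (HasExp.one_add (by decide +kernel)).ne_zero
  have hG0 : 1 + gen q .y * gen q (.e 11) ≠ 0 := (HasExp.one_add (by decide +kernel)).ne_zero
  have hc := fun i j => qComm_s₀Exp i (genList_isMonomialOrder.mem i) j
    (genList_isMonomialOrder.mem j)
  refine qCommute_of_special [.x, .τ 10, .τ 11, .σ 1] ?_ ?_ ?_ i j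
  · intro i hi j hj
    obtain ⟨n, _⟩ := s₀Image_isTerm (q := q) hi
    obtain ⟨m, _⟩ := s₀Image_isTerm (q := q) hj
    exact QCommute.of_isTerm (hc i j)
  · intro i hi j hj
    obtain ⟨m, _⟩ := s₀Image_isTerm (q := q) hj
    -- $F$ and $G$ commute with the images of all non-special generators, so the $q$-exponent of
    -- each mixed pair is that of the monomial parts.
    have hFj : QCommute 0 (1 + gen q .y * (gen q (.h 2) / gen q (.e 10))) (s₀Image q j) :=
      QCommute.one_add ((by decide +kernel : ∀ j ∈ genList, j ∉ [Gen.x, .τ 10, .τ 11, .σ 1] →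
        qComm (genExp .y + (genExp (.h 2) + -genExp (.e 10))) (s₀Exp j) = 0) j
          (genList_isMonomialOrder.mem j) hj)
    have hGj : QCommute 0 (1 + gen q .y * gen q (.e 11)) (s₀Image q j) :=
      QCommute.one_add ((by decide +kernel : ∀ j ∈ genList, j ∉ [Gen.x, .τ 10, .τ 11, .σ 1] →
        qComm (genExp .y + genExp (.e 11)) (s₀Exp j) = 0) j
          (genList_isMonomialOrder.mem j) hj)
    have hc := fun i => hc i j
    simp only [List.mem_cons, List.not_mem_nil, or_false] at hi
    rcases hi with rfl | rfl | rfl | rfl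
    · exact ((QCommute.of_isTerm (x := gen q .x) (hc .x)).mul_left (hFj.div_left hGj)).congr
        (by ring)
    · exact (hGj.mul_left (QCommute.of_isTerm (x := gen q (.σ 2) / gen q (.τ 11))
        (hc (.τ 10)))).congr (by ring)
    · exact ((QCommute.of_isTerm (x := gen q (.σ 2) / gen q (.τ 10))
        (hc (.τ 11))).mul_left hFj).congr (by ring)
    · exact (hGj.mul_left (QCommute.of_isTerm (x := gen q (.σ 1) * gen q (.σ 2) /
        (gen q (.τ 10) * gen q (.τ 11))) (hc (.σ 1)))).congr (by ring)
  · simp only [List.pairwise_cons, List.mem_cons, List.not_mem_nil, or_false, forall_eq_or_imp,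
      forall_eq, List.Pairwise.nil, and_true, IsEmpty.forall_iff, implies_true]
    -- The special generators commute pairwise. Only the image of $x$ has a sum in its denominator;
    -- the last three pairs are within reach of the term calculus.
    refine ⟨⟨?_, ?_, ?_⟩, ⟨?_, ?_⟩, ?_⟩ <;> refine Commute.qCommute ?_
    · exact commute_mul_div_mul_left hG0 (eq_of_terms (by decide +kernel))
        (eq_of_terms (by decide +kernel)) (eq_of_terms (by decide +kernel))
        (eq_of_terms (by decide +kernel))
    · exact commute_mul_div_mul_right (eq_of_terms (by decide +kernel))
        (eq_of_terms (by decide +kernel)) (eq_of_terms (by decide +kernel))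
    · exact commute_mul_div_mul_left hG0 (eq_of_terms (by decide +kernel))
        (eq_of_terms (by decide +kernel)) (eq_of_terms (by decide +kernel))
        (eq_of_terms (by decide +kernel))
    · change Commute ((1 + gen q .y * gen q (.e 11)) * (gen q (.σ 2) / gen q (.τ 11)))
        (gen q (.σ 2) / gen q (.τ 10) * (1 + gen q .y * (gen q (.h 2) / gen q (.e 10))))
      exact eq_of_terms (by decide +kernel)
    · change Commute ((1 + gen q .y * gen q (.e 11)) * (gen q (.σ 2) / gen q (.τ 11)))
        ((1 + gen q .y * gen q (.e 11)) *
          (gen q (.σ 1) * gen q (.σ 2) / (gen q (.τ 10) * gen q (.τ 11))))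
      exact eq_of_terms (by decide +kernel)
    · change Commute (gen q (.σ 2) / gen q (.τ 10) * (1 + gen q .y * (gen q (.h 2) / gen q (.e 10))))
        ((1 + gen q .y * gen q (.e 11)) *
          (gen q (.σ 1) * gen q (.σ 2) / (gen q (.τ 10) * gen q (.τ 11))))
      exact eq_of_terms (by decide +kernel)

lemma qCommute_s₃Image (i j : Gen) :
    QCommute ((qWeight i j : ℤ) - qWeight j i) (s₃Image q i) (s₃Image q j) := by
  have hP0 : 1 + gen q .x * (gen q (.e 7) / gen q (.h 1)) ≠ 0 :=
    (HasExp.one_add (by decide +kernel)).ne_zero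
  have hQ0 : 1 + gen q .x / gen q (.e 1) ≠ 0 := (HasExp.one_add (by decide +kernel)).ne_zero
  have hc := fun i j => qComm_s₃Exp i (genList_isMonomialOrder.mem i) j
    (genList_isMonomialOrder.mem j)
  refine qCommute_of_special [.y, .τ 1, .τ 7, .σ 2] ?_ ?_ ?_ i j
  · intro i hi j hj
    obtain ⟨n, _⟩ := s₃Image_isTerm (q := q) hi
    obtain ⟨m, _⟩ := s₃Image_isTerm (q := q) hj
    exact QCommute.of_isTerm (hc i j)
  · intro i hi j hj
    obtain ⟨m, _⟩ := s₃Image_isTerm (q := q) hj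
    have hPj : QCommute 0 (1 + gen q .x * (gen q (.e 7) / gen q (.h 1))) (s₃Image q j) :=
      QCommute.one_add ((by decide +kernel : ∀ j ∈ genList, j ∉ [Gen.y, .τ 1, .τ 7, .σ 2] →
        qComm (genExp .x + (genExp (.e 7) + -genExp (.h 1))) (s₃Exp j) = 0) j
          (genList_isMonomialOrder.mem j) hj)
    have hQj : QCommute 0 (1 + gen q .x / gen q (.e 1)) (s₃Image q j) :=
      QCommute.one_add ((by decide +kernel : ∀ j ∈ genList, j ∉ [Gen.y, .τ 1, .τ 7, .σ 2] →
        qComm (genExp .x + -genExp (.e 1)) (s₃Exp j) = 0) j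
          (genList_isMonomialOrder.mem j) hj)
    have hc := fun i => hc i j
    simp only [List.mem_cons, List.not_mem_nil, or_false] at hi
    rcases hi with rfl | rfl | rfl | rfl
    · exact ((hPj.div_left hQj).mul_left (QCommute.of_isTerm (x := gen q .y) (hc .y))).congr
        (by ring)
    · exact (hPj.mul_left (QCommute.of_isTerm (x := gen q (.σ 1) / gen q (.τ 7))
        (hc (.τ 1)))).congr (by ring)
    · exact ((QCommute.of_isTerm (x := gen q (.σ 1) / gen q (.τ 1))
        (hc (.τ 7))).mul_left hQj).congr (by ring)
    · exact ((QCommute.of_isTerm (x := gen q (.σ 1) * gen q (.σ 2) /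
        (gen q (.τ 1) * gen q (.τ 7))) (hc (.σ 2))).mul_left hQj).congr (by ring)
  · simp only [List.pairwise_cons, List.mem_cons, List.not_mem_nil, or_false, forall_eq_or_imp,
      forall_eq, List.Pairwise.nil, and_true, IsEmpty.forall_iff, implies_true]
    -- As for $s_0$, with $y$ in place of $x$ as the only image with a sum in its denominator.
    refine ⟨⟨?_, ?_, ?_⟩, ⟨?_, ?_⟩, ?_⟩ <;> refine Commute.qCommute ?_
    · exact commute_div_mul_mul_left (eq_of_terms (by decide +kernel))
        (eq_of_terms (by decide +kernel)) (eq_of_terms (by decide +kernel))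
    · exact commute_div_mul_mul_right hQ0 (eq_of_terms (by decide +kernel))
        (eq_of_terms (by decide +kernel)) (eq_of_terms (by decide +kernel))
        (eq_of_terms (by decide +kernel))
    · exact commute_div_mul_mul_right hQ0 (eq_of_terms (by decide +kernel))
        (eq_of_terms (by decide +kernel)) (eq_of_terms (by decide +kernel))
        (eq_of_terms (by decide +kernel))
    · change Commute ((1 + gen q .x * (gen q (.e 7) / gen q (.h 1))) *
        (gen q (.σ 1) / gen q (.τ 7))) (gen q (.σ 1) / gen q (.τ 1) * (1 + gen q .x / gen q (.e 1)))
      exact eq_of_terms (by decide +kernel)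
    · change Commute ((1 + gen q .x * (gen q (.e 7) / gen q (.h 1))) *
        (gen q (.σ 1) / gen q (.τ 7)))
        (gen q (.σ 1) * gen q (.σ 2) / (gen q (.τ 1) * gen q (.τ 7)) *
          (1 + gen q .x / gen q (.e 1)))
      exact eq_of_terms (by decide +kernel)
    · change Commute (gen q (.σ 1) / gen q (.τ 1) * (1 + gen q .x / gen q (.e 1)))
        (gen q (.σ 1) * gen q (.σ 2) / (gen q (.τ 1) * gen q (.τ 7)) *
          (1 + gen q .x / gen q (.e 1)))
      exact eq_of_terms (by decide +kernel)

lemma mem_genList (g : Gen) : g ∈ genList := genList_isMonomialOrder.mem g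

variable (q) in
lemma exists_actsBy_s₀Image : ∃ φ : SkewK q →ₐ[𝕜] SkewK q, ActsBy φ (s₀Image q) :=
  exists_actsBy s₀Exp qCommute_s₀Image hasExp_s₀Image fun i j =>
    s₀Exp_involutive i (mem_genList i) j (mem_genList j)

variable (q) in
lemma exists_actsBy_s₃Image : ∃ φ : SkewK q →ₐ[𝕜] SkewK q, ActsBy φ (s₃Image q) :=
  exists_actsBy s₃Exp qCommute_s₃Image hasExp_s₃Image fun i j =>
    s₃Exp_involutive i (mem_genList i) j (mem_genList j)

/-- The permutation of the generators `e_i`, `τ_i` induced by a permutation of the indices. -/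
def permGen (π : Equiv.Perm (Fin 11)) : Gen → Gen
  | .e k => .e (π k)
  | .τ k => .τ (π k)
  | g => g

lemma permGen_mul (π π' : Equiv.Perm (Fin 11)) (g : Gen) :
    permGen (π * π') g = permGen π (permGen π' g) := by
  cases g <;> rfl

lemma permGen_one (g : Gen) : permGen 1 g = g := by
  cases g <;> rfl

lemma swapImage_eq (i j : Fin 11) : swapImage q i j = fun g => gen q (permGen (Equiv.swap i j) g) := by
  funext g
  cases g <;> rfl

variable (q) in
lemma exists_actsBy_permGen (π : Equiv.Perm (Fin 11)) :
    ∃ φ : SkewK q →ₐ[𝕜] SkewK q, ActsBy φ fun g => gen q (permGen π g) := by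
  refine exists_actsBy (T := fun g => genExp (permGen π g)) (fun g => genExp (permGen π⁻¹ g))
    (fun i j => ?_) (fun i => HasExp.of_isTerm) (fun i j => ?_)
  · refine QCommute.of_isTerm ?_
    have h : ∀ i j, qComm (genExp i) (genExp j) = (qWeight i j : ℤ) - qWeight j i := fun i j =>
      (by decide +kernel : ∀ i ∈ genList, ∀ j ∈ genList,
        qComm (genExp i) (genExp j) = (qWeight i j : ℤ) - qWeight j i) i (mem_genList i)
          j (mem_genList j)
    rw [h]
    cases i <;> cases j <;> simp [permGen, qWeight]
  · rw [genList_isMonomialOrder.sum_map]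
    simp only [genExp, ite_mul, one_mul, zero_mul, Finset.sum_ite_eq, Finset.mem_univ, if_true]
    rw [← permGen_mul, inv_mul_cancel, permGen_one]

end Endomorphisms

/-! ### The involutions, the commutation relations with index swaps, and the braid relations of
$s_3$ with its neighbours in the chain. -/

section Involutions

variable {𝕜 : Type*} [Field 𝕜] {q : 𝕜ˣ}

/-- The generators which are not fixed by `s₀`. -/
def moved₀ : List Gen := [.e 10, .e 11, .h 1, .x, .τ 10, .τ 11, .σ 1]

/-- The generators which are not fixed by `s₃`. -/
def moved₃ : List Gen := [.e 1, .e 7, .h 2, .y, .τ 1, .τ 7, .σ 2]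

lemma s₀Image_of_notMem {g : Gen} (hg : g ∉ moved₀) : s₀Image q g = gen q g := by
  simp only [moved₀, List.mem_cons, List.not_mem_nil, or_false, not_or] at hg
  unfold s₀Image
  dsimp only
  simp only [hg, if_false]

lemma s₃Image_of_notMem {g : Gen} (hg : g ∉ moved₃) : s₃Image q g = gen q g := by
  simp only [moved₃, List.mem_cons, List.not_mem_nil, or_false, not_or] at hg
  unfold s₃Image
  dsimp only
  simp only [hg, if_false]

lemma ActsBy.s₀_eqs {φ : SkewK q →ₐ[𝕜] SkewK q} (h : ActsBy φ (s₀Image q)) :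
    φ (gen q (.e 10)) = gen q (.h 2) / gen q (.e 11) ∧
    φ (gen q (.e 11)) = gen q (.h 2) / gen q (.e 10) ∧
    φ (gen q (.h 1)) = gen q (.h 1) * gen q (.h 2) / (gen q (.e 10) * gen q (.e 11)) ∧
    φ (gen q .x) = gen q .x *
      ((1 + gen q .y * (gen q (.h 2) / gen q (.e 10))) / (1 + gen q .y * gen q (.e 11))) ∧
    φ (gen q (.τ 10)) = (1 + gen q .y * gen q (.e 11)) * (gen q (.σ 2) / gen q (.τ 11)) ∧
    φ (gen q (.τ 11))
      = gen q (.σ 2) / gen q (.τ 10) * (1 + gen q .y * (gen q (.h 2) / gen q (.e 10))) ∧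
    φ (gen q (.σ 1)) = (1 + gen q .y * gen q (.e 11)) *
      (gen q (.σ 1) * gen q (.σ 2) / (gen q (.τ 10) * gen q (.τ 11))) ∧
    φ (gen q (.e 1)) = gen q (.e 1) ∧ φ (gen q (.e 7)) = gen q (.e 7) ∧
    φ (gen q (.h 2)) = gen q (.h 2) ∧ φ (gen q .y) = gen q .y ∧
    φ (gen q (.τ 1)) = gen q (.τ 1) ∧ φ (gen q (.τ 7)) = gen q (.τ 7) ∧
    φ (gen q (.σ 2)) = gen q (.σ 2) :=
  ⟨h _, h _, h _, h _, h _, h _, h _, h _, h _, h _, h _, h _, h _, h _⟩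

lemma ActsBy.s₃_eqs {φ : SkewK q →ₐ[𝕜] SkewK q} (h : ActsBy φ (s₃Image q)) :
    φ (gen q (.e 1)) = gen q (.h 1) / gen q (.e 7) ∧
    φ (gen q (.e 7)) = gen q (.h 1) / gen q (.e 1) ∧
    φ (gen q (.h 2)) = gen q (.h 1) * gen q (.h 2) / (gen q (.e 1) * gen q (.e 7)) ∧
    φ (gen q .y) = (1 + gen q .x * (gen q (.e 7) / gen q (.h 1))) /
      (1 + gen q .x / gen q (.e 1)) * gen q .y ∧
    φ (gen q (.τ 1)) = (1 + gen q .x * (gen q (.e 7) / gen q (.h 1))) *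
      (gen q (.σ 1) / gen q (.τ 7)) ∧
    φ (gen q (.τ 7)) = gen q (.σ 1) / gen q (.τ 1) * (1 + gen q .x / gen q (.e 1)) ∧
    φ (gen q (.σ 2)) = gen q (.σ 1) * gen q (.σ 2) / (gen q (.τ 1) * gen q (.τ 7)) *
      (1 + gen q .x / gen q (.e 1)) ∧
    φ (gen q (.e 10)) = gen q (.e 10) ∧ φ (gen q (.e 11)) = gen q (.e 11) ∧
    φ (gen q (.h 1)) = gen q (.h 1) ∧ φ (gen q .x) = gen q .x ∧
    φ (gen q (.τ 10)) = gen q (.τ 10) ∧ φ (gen q (.τ 11)) = gen q (.τ 11) ∧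
    φ (gen q (.σ 1)) = gen q (.σ 1) :=
  ⟨h _, h _, h _, h _, h _, h _, h _, h _, h _, h _, h _, h _, h _, h _⟩

variable (q) in
lemma factor₀_ne_zero : 1 + gen q .y * (gen q (.h 2) / gen q (.e 10)) ≠ 0 :=
  (HasExp.one_add (by decide +kernel)).ne_zero

variable (q) in
lemma factor₀_ne_zero' : 1 + gen q .y * gen q (.e 11) ≠ 0 :=
  (HasExp.one_add (by decide +kernel)).ne_zero

variable (q) in
lemma factor₃_ne_zero : 1 + gen q .x * (gen q (.e 7) / gen q (.h 1)) ≠ 0 :=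
  (HasExp.one_add (by decide +kernel)).ne_zero

variable (q) in
lemma factor₃_ne_zero' : 1 + gen q .x / gen q (.e 1) ≠ 0 :=
  (HasExp.one_add (by decide +kernel)).ne_zero

lemma mul_div_mul_of_commute {A : Type*} [DivisionRing A] {F s m : A} (hF : F ≠ 0)
    (h : Commute F s) : F * (s / (m * F)) = s / m := by
  rw [div_eq_mul_inv, mul_inv_rev, ← mul_assoc, ← mul_assoc, h.eq, mul_assoc s,
    mul_inv_cancel₀ hF, mul_one, div_eq_mul_inv]

lemma div_mul_left_mul_cancel {A : Type*} [DivisionRing A] {G s m : A} (hG : G ≠ 0) :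
    s / (G * m) * G = s / m := by
  rw [div_eq_mul_inv, mul_inv_rev, mul_assoc, mul_assoc, inv_mul_cancel₀ hG, mul_one,
    div_eq_mul_inv]

lemma mul_div_mul_left_of_commute {A : Type*} [DivisionRing A] {G s m : A} (hG : G ≠ 0)
    (h : Commute G (s / m)) : G * s / (G * m) = s / m := by
  rw [div_eq_mul_inv, mul_inv_rev, ← mul_assoc, mul_assoc G, ← div_eq_mul_inv s, h.eq, mul_assoc,
    mul_inv_cancel₀ hG, mul_one]

/-- `φ` exchanges $F$ and $G$. Thus $x\mapsto x(F/G)\mapsto x(F/G)(G/F)=x$, and in the images of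
$\tau_{10},\tau_{11},\sigma_1$ the factors cancel likewise, leaving monomials to compare. -/
lemma ActsBy.s₀_involutive {φ : SkewK q →ₐ[𝕜] SkewK q} (h : ActsBy φ (s₀Image q)) (g : Gen) :
    φ (φ (gen q g)) = gen q g := by
  have hF0 := factor₀_ne_zero q
  have hG0 := factor₀_ne_zero' q
  have he : gen q (.h 2) / (gen q (.h 2) / gen q (.e 11)) = gen q (.e 11) :=
    eq_of_terms (by decide +kernel)
  by_cases hg : g ∈ moved₀
  · simp only [moved₀, List.mem_cons, List.not_mem_nil, or_false] at hg
    rcases hg with rfl | rfl | rfl | rfl | rfl | rfl | rfl <;>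
      simp only [h.s₀_eqs, map_div₀, map_mul, map_add, map_one]
    · exact eq_of_terms (by decide +kernel)
    · exact eq_of_terms (by decide +kernel)
    · exact eq_of_terms (by decide +kernel)
    · rw [he, mul_assoc, div_mul_div_cancel₀ hG0, div_self hF0, mul_one]
    · rw [mul_div_mul_of_commute hF0 (eq_of_terms (by decide +kernel))]
      exact eq_of_terms (by decide +kernel)
    · rw [he, div_mul_left_mul_cancel hG0]
      exact eq_of_terms (by decide +kernel)
    · rw [← mul_assoc (_ * (gen q (.σ 2) / gen q (.τ 11))), mul_div_mul_of_commute hF0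
        (eq_of_terms (by decide +kernel)), mul_assoc, mul_assoc,
        mul_div_mul_left_of_commute hG0 (eq_of_terms (by decide +kernel))]
      exact eq_of_terms (by decide +kernel)
  · have : φ (gen q g) = gen q g := by rw [h, s₀Image_of_notMem hg]
    rw [this, this]

/-- `φ` exchanges $P$ and $Q$; `he` and `he'` are the monomial identities behind this. -/
lemma ActsBy.s₃_involutive {φ : SkewK q →ₐ[𝕜] SkewK q} (h : ActsBy φ (s₃Image q)) (g : Gen) :
    φ (φ (gen q g)) = gen q g := by
  have hP0 := factor₃_ne_zero q
  have hQ0 := factor₃_ne_zero' q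
  have he : gen q .x * (gen q (.h 1) / gen q (.e 1) / gen q (.h 1)) = gen q .x / gen q (.e 1) :=
    eq_of_terms (by decide +kernel)
  have he' : gen q .x / (gen q (.h 1) / gen q (.e 7)) = gen q .x * (gen q (.e 7) / gen q (.h 1)) :=
    eq_of_terms (by decide +kernel)
  by_cases hg : g ∈ moved₃
  · simp only [moved₃, List.mem_cons, List.not_mem_nil, or_false] at hg
    rcases hg with rfl | rfl | rfl | rfl | rfl | rfl | rfl <;>
      simp only [h.s₃_eqs, map_div₀, map_mul, map_add, map_one]
    · exact eq_of_terms (by decide +kernel)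
    · exact eq_of_terms (by decide +kernel)
    · exact eq_of_terms (by decide +kernel)
    · rw [he, he', ← mul_assoc, div_mul_div_cancel₀ hP0, div_self hQ0, one_mul]
    · rw [he, mul_div_mul_of_commute hQ0 (eq_of_terms (by decide +kernel))]
      exact eq_of_terms (by decide +kernel)
    · rw [he', div_mul_left_mul_cancel hP0]
      exact eq_of_terms (by decide +kernel)
    · rw [he', ← mul_assoc (gen q (.σ 1)), ← mul_assoc (_ * (gen q (.σ 1) / gen q (.τ 7))),
        mul_div_mul_right _ _ hQ0, mul_assoc (1 + _), div_mul_left_mul_cancel hP0]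
      exact eq_of_terms (by decide +kernel)
  · have : φ (gen q g) = gen q g := by rw [h, s₃Image_of_notMem hg]
    rw [this, this]

lemma ActsBy.permGen_mul {π π' : Equiv.Perm (Fin 11)} {φ ψ : SkewK q →ₐ[𝕜] SkewK q}
    (hφ : ActsBy φ fun g => gen q (permGen π g)) (hψ : ActsBy ψ fun g => gen q (permGen π' g)) :
    ActsBy (φ.comp ψ) fun g => gen q (permGen (π * π') g) := fun g => by
  dsimp only
  rw [_root_.permGen_mul]
  exact (congrArg φ (hψ g)).trans (hφ _)

lemma permGen_notMem {π : Equiv.Perm (Fin 11)} {L : List Gen}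
    (h : ∀ g ∈ L, permGen π g = g) {g : Gen} (hg : g ∉ L) : permGen π g ∉ L := by
  intro h'
  have h1 := h _ h'
  have h2 : Function.Injective (permGen π) := fun a b e => by
    have := congrArg (permGen π⁻¹) e
    rwa [← _root_.permGen_mul, ← _root_.permGen_mul, inv_mul_cancel, permGen_one, permGen_one]
      at this
  exact hg (h2 h1 ▸ h')

/-- The formulas of $s_0$ involve only generators which `ψ` fixes, and `ψ` permutes the generators
which $s_0$ fixes. -/
lemma ActsBy.s₀_comm_permGen {π : Equiv.Perm (Fin 11)} {φ ψ : SkewK q →ₐ[𝕜] SkewK q}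
    (hφ : ActsBy φ (s₀Image q)) (hψ : ActsBy ψ fun g => gen q (permGen π g))
    (hπ : ∀ g ∈ moved₀, permGen π g = g) (g : Gen) :
    φ (ψ (gen q g)) = ψ (φ (gen q g)) := by
  rw [hψ g]
  dsimp only
  by_cases hg : g ∈ moved₀
  · have h : ∀ g ∈ moved₀, ψ (gen q g) = gen q g := fun g hg => by
      rw [hψ g]
      dsimp only
      rw [hπ g hg]
    have hh : ψ (gen q (.h 2)) = gen q (.h 2) := hψ _
    have hy : ψ (gen q .y) = gen q .y := hψ _
    have hσ : ψ (gen q (.σ 2)) = gen q (.σ 2) := hψ _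
    rw [hπ g hg]
    simp only [moved₀, List.mem_cons, List.not_mem_nil, or_false, forall_eq_or_imp, forall_eq]
      at hg h
    rcases hg with rfl | rfl | rfl | rfl | rfl | rfl | rfl <;>
      simp only [hφ.s₀_eqs, h, hh, hy, hσ, map_div₀, map_mul, map_add, map_one]
  · have h1 := permGen_notMem hπ hg
    rw [hφ, hφ, s₀Image_of_notMem hg, s₀Image_of_notMem h1, hψ]

lemma ActsBy.s₃_comm_permGen {π : Equiv.Perm (Fin 11)} {φ ψ : SkewK q →ₐ[𝕜] SkewK q}
    (hφ : ActsBy φ (s₃Image q)) (hψ : ActsBy ψ fun g => gen q (permGen π g))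
    (hπ : ∀ g ∈ moved₃, permGen π g = g) (g : Gen) :
    φ (ψ (gen q g)) = ψ (φ (gen q g)) := by
  rw [hψ g]
  dsimp only
  by_cases hg : g ∈ moved₃
  · have h : ∀ g ∈ moved₃, ψ (gen q g) = gen q g := fun g hg => by
      rw [hψ g]
      dsimp only
      rw [hπ g hg]
    have hh : ψ (gen q (.h 1)) = gen q (.h 1) := hψ _
    have hx : ψ (gen q .x) = gen q .x := hψ _
    have hσ : ψ (gen q (.σ 1)) = gen q (.σ 1) := hψ _
    rw [hπ g hg]
    simp only [moved₃, List.mem_cons, List.not_mem_nil, or_false, forall_eq_or_imp, forall_eq]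
      at hg h
    rcases hg with rfl | rfl | rfl | rfl | rfl | rfl | rfl <;>
      simp only [hφ.s₃_eqs, h, hh, hx, hσ, map_div₀, map_mul, map_add, map_one]
  · have h1 := permGen_notMem hπ hg
    rw [hφ, hφ, s₃Image_of_notMem hg, s₃Image_of_notMem h1, hψ]

lemma swapImage_of_notMem {i j : Fin 11} {g : Gen} (hg : g ∉ [.e i, .e j, .τ i, .τ j]) :
    swapImage q i j g = gen q g := by
  simp only [List.mem_cons, List.not_mem_nil, or_false, not_or] at hg
  cases g with
  | e k =>
    simp only [Gen.e.injEq] at hg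
    rw [swapImage, Equiv.swap_apply_of_ne_of_ne hg.1 hg.2.1]
  | τ k =>
    simp only [Gen.τ.injEq] at hg
    rw [swapImage, Equiv.swap_apply_of_ne_of_ne hg.2.2.1 hg.2.2.2]
  | _ => rfl

/-- Let $P'=1+x\,e_8/h_1$ be the image of $P$ under the swap; $Q$ is unchanged by it. Since $s_3$
sends $Q$ to $P$ and fixes $P'$, the image of $y$ telescopes: $(P'/P)(P/Q)y=(P'/Q)y$. -/
lemma ActsBy.s₃_braid_swap_7_8 {φ ψ : SkewK q →ₐ[𝕜] SkewK q}
    (hφ : ActsBy φ (s₃Image q)) (hψ : ActsBy ψ (swapImage q 7 8)) (g : Gen) :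
    φ (ψ (φ (gen q g))) = ψ (φ (ψ (gen q g))) := by
  have hP0 := factor₃_ne_zero q
  have hQ0 := factor₃_ne_zero' q
  have h7 : ψ (gen q (.e 7)) = gen q (.e 8) := hψ _
  have h8 : ψ (gen q (.e 8)) = gen q (.e 7) := hψ _
  have t7 : ψ (gen q (.τ 7)) = gen q (.τ 8) := hψ _
  have t8 : ψ (gen q (.τ 8)) = gen q (.τ 7) := hψ _
  have f7 : φ (gen q (.e 8)) = gen q (.e 8) := hφ _
  have f8 : φ (gen q (.τ 8)) = gen q (.τ 8) := hφ _
  have he1 : ψ (gen q (.e 1)) = gen q (.e 1) := hψ _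
  have ht1 : ψ (gen q (.τ 1)) = gen q (.τ 1) := hψ _
  have hh1 : ψ (gen q (.h 1)) = gen q (.h 1) := hψ _
  have hh2 : ψ (gen q (.h 2)) = gen q (.h 2) := hψ _
  have hx : ψ (gen q .x) = gen q .x := hψ _
  have hy : ψ (gen q .y) = gen q .y := hψ _
  have hσ1 : ψ (gen q (.σ 1)) = gen q (.σ 1) := hψ _
  have hσ2 : ψ (gen q (.σ 2)) = gen q (.σ 2) := hψ _
  have he' : gen q .x / (gen q (.h 1) / gen q (.e 7)) = gen q .x * (gen q (.e 7) / gen q (.h 1)) :=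
    eq_of_terms (by decide +kernel)
  by_cases hg : g ∈ .e 8 :: .τ 8 :: moved₃
  · simp only [moved₃, List.mem_cons, List.not_mem_nil, or_false] at hg
    rcases hg with rfl | rfl | rfl | rfl | rfl | rfl | rfl | rfl | rfl <;>
      simp only [hφ.s₃_eqs, h7, h8, t7, t8, f7, f8, he1, ht1, hh1, hh2, hx, hy, hσ1, hσ2, map_div₀,
        map_mul, map_add, map_one]
    · exact eq_of_terms (by decide +kernel)
    · exact eq_of_terms (by decide +kernel)
    · rw [he', ← mul_assoc, div_mul_div_cancel₀ hP0]
    · rw [he', div_mul_left_mul_cancel hP0]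
      exact eq_of_terms (by decide +kernel)
    · rw [he', mul_assoc (1 + _), div_mul_left_mul_cancel hP0]
      exact eq_of_terms (by decide +kernel)
  · have h1 : φ (gen q g) = gen q g := by
      rw [hφ, s₃Image_of_notMem fun h => hg (by simp [h])]
    have h2 : ψ (gen q g) = gen q g := by
      rw [hψ, swapImage_of_notMem]
      simp only [moved₃, List.mem_cons, List.not_mem_nil, or_false, not_or] at hg ⊢
      tauto
    rw [h1, h2, h1, h2]

lemma div_mul_div_of_commute {A : Type*} [DivisionRing A] {P Q R : A} (hQ : Q ≠ 0)
    (hPQ : Commute P Q) (hPR : Commute P R) (hQR : Commute Q R) : Q / R * (P / Q) = P / R := by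
  have h1 : P / Q = Q⁻¹ * P := by rw [div_eq_mul_inv, hPQ.inv_right₀.eq]
  rw [h1, div_eq_mul_inv, hQR.inv_right₀.eq, mul_assoc, mul_inv_cancel_left₀ hQ,
    ← hPR.inv_right₀.eq, div_eq_mul_inv]

/-- Now $P$ is unchanged and $Q$ becomes $Q'=1+x/e_2$; since $s_3$ sends $P$ to $Q$, the image of
$y$ is $(Q/Q')(P/Q)y=(P/Q')y$. -/
lemma ActsBy.s₃_braid_swap_1_2 {φ ψ : SkewK q →ₐ[𝕜] SkewK q}
    (hφ : ActsBy φ (s₃Image q)) (hψ : ActsBy ψ (swapImage q 1 2)) (g : Gen) :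
    φ (ψ (φ (gen q g))) = ψ (φ (ψ (gen q g))) := by
  have hQ0 := factor₃_ne_zero' q
  have h1 : ψ (gen q (.e 1)) = gen q (.e 2) := hψ _
  have h2 : ψ (gen q (.e 2)) = gen q (.e 1) := hψ _
  have t1 : ψ (gen q (.τ 1)) = gen q (.τ 2) := hψ _
  have t2 : ψ (gen q (.τ 2)) = gen q (.τ 1) := hψ _
  have f1 : φ (gen q (.e 2)) = gen q (.e 2) := hφ _
  have f2 : φ (gen q (.τ 2)) = gen q (.τ 2) := hφ _
  have he7 : ψ (gen q (.e 7)) = gen q (.e 7) := hψ _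
  have ht7 : ψ (gen q (.τ 7)) = gen q (.τ 7) := hψ _
  have hh1 : ψ (gen q (.h 1)) = gen q (.h 1) := hψ _
  have hh2 : ψ (gen q (.h 2)) = gen q (.h 2) := hψ _
  have hx : ψ (gen q .x) = gen q .x := hψ _
  have hy : ψ (gen q .y) = gen q .y := hψ _
  have hσ1 : ψ (gen q (.σ 1)) = gen q (.σ 1) := hψ _
  have hσ2 : ψ (gen q (.σ 2)) = gen q (.σ 2) := hψ _
  have he : gen q .x * (gen q (.h 1) / gen q (.e 1) / gen q (.h 1)) = gen q .x / gen q (.e 1) :=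
    eq_of_terms (by decide +kernel)
  by_cases hg : g ∈ .e 2 :: .τ 2 :: moved₃
  · simp only [moved₃, List.mem_cons, List.not_mem_nil, or_false] at hg
    rcases hg with rfl | rfl | rfl | rfl | rfl | rfl | rfl | rfl | rfl <;>
      simp only [hφ.s₃_eqs, h1, h2, t1, t2, f1, f2, he7, ht7, hh1, hh2, hx, hy, hσ1, hσ2, map_div₀,
        map_mul, map_add, map_one]
    · exact eq_of_terms (by decide +kernel)
    · exact eq_of_terms (by decide +kernel)
    · rw [he, ← mul_assoc, div_mul_div_of_commute hQ0 (eq_of_terms (by decide +kernel))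
        (eq_of_terms (by decide +kernel)) (eq_of_terms (by decide +kernel))]
    · rw [he, mul_div_mul_of_commute hQ0 (eq_of_terms (by decide +kernel))]
      exact eq_of_terms (by decide +kernel)
    · rw [← mul_assoc (gen q (.σ 1)), ← mul_assoc (gen q (.τ 2)), mul_div_mul_right _ _ hQ0]
      exact eq_of_terms (by decide +kernel)
  · have h1 : φ (gen q g) = gen q g := by
      rw [hφ, s₃Image_of_notMem fun h => hg (by simp [h])]
    have h2 : ψ (gen q g) = gen q g := by
      rw [hψ, swapImage_of_notMem]
      simp only [moved₃, List.mem_cons, List.not_mem_nil, or_false, not_or] at hg ⊢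
      tauto
    rw [h1, h2, h1, h2]

end Involutions

/-! ### Division-ring identities for clearing and cancelling the sum factors. -/

section DivisionRing

variable {A : Type*} [DivisionRing A]

/-- Pulls the denominator $Q$ out on the left in the images of $F$ and $G$ under $s_3$. -/
lemma one_add_div_mul {P Q t : A} (hQ : Q ≠ 0) (hPQ : Commute P Q) :
    1 + P / Q * t = Q⁻¹ * (Q + P * t) := by
  rw [mul_add, inv_mul_cancel₀ hQ, div_eq_mul_inv, hPQ.inv_right₀.eq, mul_assoc]

/-- Pulls the denominator $G$ out on the right in the images of $P$ and $Q$ under $s_0$. -/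
lemma one_add_mul_div_mul {F G X c : A} (hG : G ≠ 0) (hcG : Commute c G) :
    1 + X * (F / G) * c = (G + X * F * c) * G⁻¹ := by
  rw [add_mul, mul_inv_cancel₀ hG, mul_assoc (X * F), hcG.inv_right₀.eq, div_eq_mul_inv]
  noncomm_ring

/-- Shows that the cleared numerators acquire the right factor $F/G$ under $s_0$: here $F=G(F/G)$,
and $F/G$ passes through `c` and `c'`. -/
lemma add_mul_div_mul {F G X c X' c' : A} (hG : G ≠ 0) (hFG : Commute F G) (hcF : Commute c F)
    (hcG : Commute c G) (hcF' : Commute c' F) (hcG' : Commute c' G) :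
    F + X * (F / G) * c + X' * (F / G) * c' = (G + X * c + X' * c') * (F / G) := by
  have h1 : G * (F / G) = F := by
    rw [← mul_div_assoc, ← hFG.eq, mul_div_assoc, div_self hG, mul_one]
  have h2 : c * (F / G) = F / G * c := by
    rw [div_eq_mul_inv]; exact (hcF.mul_right hcG.inv_right₀).eq
  have h3 : c' * (F / G) = F / G * c' := by
    rw [div_eq_mul_inv]; exact (hcF'.mul_right hcG'.inv_right₀).eq
  rw [add_mul, add_mul, h1, mul_assoc, mul_assoc, mul_assoc X, mul_assoc X', h2, h3]

/-- The mirror image: the cleared numerators acquire the left factor $P/Q$ under $s_3$. -/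
lemma add_mul_div_mul_mul {P Q D D' y b b' : A} (hQ : Q ≠ 0) (hDP : Commute D P)
    (hDQ : Commute D Q) (hDP' : Commute D' P) (hDQ' : Commute D' Q) :
    P + D * (P / Q * y) * b + D' * (P / Q * y) * b' = P / Q * (Q + D * y * b + D' * y * b') := by
  have h2 : D * (P / Q) = P / Q * D := by
    rw [div_eq_mul_inv]; exact (hDP.mul_right hDQ.inv_right₀).eq
  have h3 : D' * (P / Q) = P / Q * D' := by
    rw [div_eq_mul_inv]; exact (hDP'.mul_right hDQ'.inv_right₀).eq
  rw [mul_add, mul_add, div_mul_cancel₀ P hQ, ← mul_assoc D, h2, ← mul_assoc D', h3]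
  simp only [mul_assoc]

lemma mul_div_mul_right_of_commute {F G s b : A} (h : Commute F s) :
    G * s / (b * F) = G / F * (s / b) := by
  simp only [div_eq_mul_inv, mul_inv_rev]
  rw [mul_assoc G s, ← mul_assoc s, ← h.inv_left₀.eq]
  simp only [mul_assoc]

lemma mul_div_mul_left_of_commute_right {P Q a b : A} (h : Commute Q b) :
    a * Q / (P * b) = a / b * (Q / P) := by
  simp only [div_eq_mul_inv, mul_inv_rev]
  rw [mul_assoc a Q, ← mul_assoc Q, h.inv_right₀.eq]
  simp only [mul_assoc]

lemma div_eq_of_commute_of_eq_inv_mul {u v Q a b : A} (hQ : Q ≠ 0) (huv : Commute u v)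
    (hu : u = Q⁻¹ * a) (hv : v = Q⁻¹ * b) : u / v = b⁻¹ * a := by
  rw [div_eq_mul_inv, huv.inv_right₀.eq, hu, hv, mul_inv_rev, inv_inv, mul_assoc,
    mul_inv_cancel_left₀ hQ]

end DivisionRing

/-! ### The braid relation between $s_0$ and $s_3$. -/

section Braid

variable {𝕜 : Type*} [Field 𝕜] {q : 𝕜ˣ}

/-- The generators in `moved₀` are fixed by `ψ`, so this invariance under `φ` is the braid relation
on them. It is proved by writing `ψ (φ (gen q g))` in terms of pieces whose behaviour under `φ` is
explicit. -/
lemma ActsBy.s₀_braid_s₃_left {φ ψ : SkewK q →ₐ[𝕜] SkewK q} (hφ : ActsBy φ (s₀Image q))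
    (hψ : ActsBy ψ (s₃Image q)) {g : Gen} (hg : g ∈ moved₀) :
    φ (ψ (φ (gen q g))) = ψ (φ (gen q g)) := by
  have hF0 := factor₀_ne_zero q
  have hG0 := factor₀_ne_zero' q
  have hQ0 := factor₃_ne_zero' q
  have he : gen q (.h 2) / (gen q (.h 2) / gen q (.e 11)) = gen q (.e 11) :=
    eq_of_terms (by decide +kernel)
  have hc : gen q .y * (gen q (.h 2) / gen q (.e 10)) * (gen q (.e 7) /
      (gen q (.h 1) * gen q (.h 2) / (gen q (.e 10) * gen q (.e 11))))
      = gen q .y * gen q (.e 11) * (gen q (.e 7) / gen q (.h 1)) :=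
    eq_of_terms (by decide +kernel)
  have hFG : (1 + gen q .y * (gen q (.h 2) / gen q (.e 10))) / (1 + gen q .y * gen q (.e 11)) *
      ((1 + gen q .y * gen q (.e 11)) / (1 + gen q .y * (gen q (.h 2) / gen q (.e 10)))) = 1 := by
    rw [div_mul_div_cancel₀ hG0, div_self hF0]
  -- `a` and `b` are $Q\,\psi(F)$ and $Q\,\psi(G)$, arranged so that the action of `φ` is visible.
  -- They are introduced opaquely to stay intact under rewriting.
  obtain ⟨a, ha⟩ : ∃ a, a = 1 + gen q .y *
      (gen q (.h 1) * gen q (.h 2) / (gen q (.e 1) * gen q (.e 7)) / gen q (.e 10)) +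
      gen q .x * (gen q (.e 1))⁻¹ * (1 + gen q .y * (gen q (.h 2) / gen q (.e 10))) := ⟨_, rfl⟩
  obtain ⟨b, hb⟩ : ∃ b, b = 1 + gen q .y * gen q (.e 11) + gen q .x * (gen q (.e 1))⁻¹ +
      gen q .x * (gen q .y * gen q (.e 11) * (gen q (.e 7) / gen q (.h 1))) := ⟨_, rfl⟩
  -- `n` is `b` with $x/e_1$ replaced by $y^{-1}xy/e_1=q^{-1}x/e_1$. This shift arises when $Q$ is
  -- moved across: $bmQ=Qnm$ for $m=\sigma_1\sigma_2/(\tau_1\tau_7\tau_{11})$. Conjugation by $y$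
  -- expresses the power of $q$ through generators alone.
  obtain ⟨n, hn⟩ : ∃ n, n = 1 + gen q .y * gen q (.e 11) +
      (gen q .y)⁻¹ * gen q .x * (gen q .y * (gen q (.e 1))⁻¹) +
      gen q .x * (gen q .y * gen q (.e 11) * (gen q (.e 7) / gen q (.h 1))) := ⟨_, rfl⟩
  have hψF : ψ (1 + gen q .y * (gen q (.h 2) / gen q (.e 10)))
      = (1 + gen q .x / gen q (.e 1))⁻¹ * a := by
    simp only [hψ.s₃_eqs, map_div₀, map_mul, map_add, map_one]
    rw [mul_assoc, one_add_div_mul hQ0 (eq_of_terms (by decide +kernel)), ha]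
    exact congrArg _ (eq_of_terms (by decide +kernel))
  have hψG : ψ (1 + gen q .y * gen q (.e 11)) = (1 + gen q .x / gen q (.e 1))⁻¹ * b := by
    simp only [hψ.s₃_eqs, map_mul, map_add, map_one]
    rw [mul_assoc, one_add_div_mul hQ0 (eq_of_terms (by decide +kernel)), hb]
    exact congrArg _ (eq_of_terms (by decide +kernel))
  have hφa : φ a = a := by
    have h1 : Commute (1 + gen q .y * (gen q (.h 2) / gen q (.e 10)))
        (1 + gen q .y * gen q (.e 11)) := eq_of_terms (by decide +kernel)
    have h2 : Commute (gen q (.e 1))⁻¹ (1 + gen q .y * gen q (.e 11)) :=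
      eq_of_terms (by decide +kernel)
    have h3 : Commute (gen q (.e 1))⁻¹ (1 + gen q .y * (gen q (.h 2) / gen q (.e 10))) :=
      eq_of_terms (by decide +kernel)
    rw [ha]
    simp only [hφ.s₀_eqs, map_div₀, map_mul, map_add, map_one, map_inv₀]
    rw [he, mul_assoc _ (gen q (.e 1))⁻¹, h2.eq, mul_assoc (gen q .x), ← mul_assoc (_ / _),
      div_mul_cancel₀ _ hG0, ← h3.eq, ← mul_assoc]
    congr 2
    exact eq_of_terms (by decide +kernel)
  have hφb : φ b = b * ((1 + gen q .y * (gen q (.h 2) / gen q (.e 10))) /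
      (1 + gen q .y * gen q (.e 11))) := by
    rw [hb]
    simp only [hφ.s₀_eqs, map_div₀, map_mul, map_add, map_one, map_inv₀]
    rw [hc, add_mul_div_mul hG0 (eq_of_terms (by decide +kernel)) (eq_of_terms (by decide +kernel))
      (eq_of_terms (by decide +kernel)) (eq_of_terms (by decide +kernel))
      (eq_of_terms (by decide +kernel))]
  have hφn : φ n = n * ((1 + gen q .y * (gen q (.h 2) / gen q (.e 10))) /
      (1 + gen q .y * gen q (.e 11))) := by
    rw [hn]
    simp only [hφ.s₀_eqs, map_div₀, map_mul, map_add, map_one, map_inv₀]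
    rw [hc, ← mul_assoc (gen q .y)⁻¹ (gen q .x),
      add_mul_div_mul hG0 (eq_of_terms (by decide +kernel)) (eq_of_terms (by decide +kernel))
      (eq_of_terms (by decide +kernel)) (eq_of_terms (by decide +kernel))
      (eq_of_terms (by decide +kernel))]
  have hφm : φ (gen q (.σ 1) * gen q (.σ 2) / (gen q (.τ 1) * gen q (.τ 7) * gen q (.τ 11)))
      = (1 + gen q .y * gen q (.e 11)) / (1 + gen q .y * (gen q (.h 2) / gen q (.e 10))) *
        (gen q (.σ 1) * gen q (.σ 2) / (gen q (.τ 1) * gen q (.τ 7) * gen q (.τ 11))) := by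
    simp only [hφ.s₀_eqs, map_div₀, map_mul]
    rw [mul_assoc (1 + _), ← mul_assoc (gen q (.τ 1) * _),
      mul_div_mul_right_of_commute (eq_of_terms (by decide +kernel))]
    exact congrArg _ (eq_of_terms (by decide +kernel))
  have hφk : φ (gen q (.σ 1) / gen q (.τ 10)) = gen q (.σ 1) / gen q (.τ 10) := by
    simp only [hφ.s₀_eqs, map_div₀]
    rw [mul_div_mul_left_of_commute hG0 (eq_of_terms (by decide +kernel))]
    exact eq_of_terms (by decide +kernel)
  -- The factor $F/G$ gained by `n` cancels the factor $G/F$ gained by the monomial after it, so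
  -- their product is `φ`-invariant.
  have hnm : ∀ m, n * ((1 + gen q .y * (gen q (.h 2) / gen q (.e 10))) /
      (1 + gen q .y * gen q (.e 11))) * ((1 + gen q .y * gen q (.e 11)) /
      (1 + gen q .y * (gen q (.h 2) / gen q (.e 10))) * m) = n * m := fun m => by
    rw [mul_assoc, ← mul_assoc (_ / _), hFG, one_mul]
  simp only [moved₀, List.mem_cons, List.not_mem_nil, or_false] at hg
  rcases hg with rfl | rfl | rfl | rfl | rfl | rfl | rfl
  · simp only [hφ.s₀_eqs, hψ.s₃_eqs, map_div₀, map_mul]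
    exact eq_of_terms (by decide +kernel)
  · simp only [hφ.s₀_eqs, hψ.s₃_eqs, map_div₀, map_mul]
    exact eq_of_terms (by decide +kernel)
  · simp only [hφ.s₀_eqs, hψ.s₃_eqs, map_div₀, map_mul]
    exact eq_of_terms (by decide +kernel)
  · have h1 : Commute (1 + gen q .y * (gen q (.h 2) / gen q (.e 10)))
        (1 + gen q .y * gen q (.e 11)) := eq_of_terms (by decide +kernel)
    -- Under `φ` the factor $F/G$ of the image of $x$ meets $(F/G)^{-1}$ from $b^{-1}$.
    have hz : ψ (φ (gen q .x)) = gen q .x * (b⁻¹ * a) := by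
      rw [hφ.s₀_eqs.2.2.2.1, map_mul, map_div₀,
        div_eq_of_commute_of_eq_inv_mul hQ0 (h1.map ψ) hψF hψG, hψ .x]
      rfl
    rw [hz]
    simp only [map_mul, map_inv₀, hφa, hφb, hφ.s₀_eqs]
    rw [mul_inv_rev, mul_assoc, mul_assoc, mul_inv_cancel_left₀ (div_ne_zero hF0 hG0)]
  · have hz : ψ (φ (gen q (.τ 10))) = n * (gen q (.σ 1) * gen q (.σ 2) /
        (gen q (.τ 1) * gen q (.τ 7) * gen q (.τ 11))) := by
      rw [hφ.s₀_eqs.2.2.2.2.1, map_mul, hψG]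
      simp only [map_div₀, hψ.s₃_eqs]
      rw [mul_assoc, inv_mul_eq_iff_eq_mul₀ hQ0, hb, hn]
      exact eq_of_terms (by decide +kernel)
    rw [hz, map_mul, hφn, hφm, hnm]
  · have hz : ψ (φ (gen q (.τ 11))) = gen q (.σ 1) / gen q (.τ 10) *
        (gen q (.σ 2) / (gen q (.τ 1) * gen q (.τ 7))) * a := by
      have h1 : gen q (.σ 1) * gen q (.σ 2) / (gen q (.τ 1) * gen q (.τ 7)) *
          (1 + gen q .x / gen q (.e 1)) / gen q (.τ 10) = gen q (.σ 1) / gen q (.τ 10) *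
          (gen q (.σ 2) / (gen q (.τ 1) * gen q (.τ 7))) * (1 + gen q .x / gen q (.e 1)) :=
        eq_of_terms (by decide +kernel)
      rw [hφ.s₀_eqs.2.2.2.2.2.1, map_mul, hψF]
      simp only [map_div₀, hψ.s₃_eqs]
      rw [h1, mul_assoc, mul_inv_cancel_left₀ hQ0]
    rw [hz, map_mul, map_mul, hφk, hφa]
    simp only [map_div₀, map_mul, hφ.s₀_eqs]
  · have hz : ψ (φ (gen q (.σ 1))) = n * (gen q (.σ 1) * gen q (.σ 2) /
        (gen q (.τ 1) * gen q (.τ 7) * gen q (.τ 11))) * (gen q (.σ 1) / gen q (.τ 10)) := by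
      rw [hφ.s₀_eqs.2.2.2.2.2.2.1, map_mul, hψG]
      simp only [map_div₀, map_mul, hψ.s₃_eqs]
      rw [mul_assoc, inv_mul_eq_iff_eq_mul₀ hQ0, hb, hn]
      exact eq_of_terms (by decide +kernel)
    rw [hz, map_mul, map_mul, hφn, hφm, hnm, hφk]

/-- The mirror image of the previous argument: denominators are cleared on the right by $G$, and the
factors $P/Q$ gained under `ψ` cancel. -/
lemma ActsBy.s₀_braid_s₃_right {φ ψ : SkewK q →ₐ[𝕜] SkewK q} (hφ : ActsBy φ (s₀Image q))
    (hψ : ActsBy ψ (s₃Image q)) {g : Gen} (hg : g ∈ moved₃) :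
    ψ (φ (ψ (gen q g))) = φ (ψ (gen q g)) := by
  have hG0 := factor₀_ne_zero' q
  have hP0 := factor₃_ne_zero q
  have hQ0 := factor₃_ne_zero' q
  have he : gen q .x * (gen q (.h 1) / gen q (.e 1) / gen q (.h 1)) = gen q .x / gen q (.e 1) :=
    eq_of_terms (by decide +kernel)
  have he' : gen q .x / (gen q (.h 1) / gen q (.e 7)) = gen q .x * (gen q (.e 7) / gen q (.h 1)) :=
    eq_of_terms (by decide +kernel)
  have hd : gen q .x * (gen q (.h 1) * gen q (.h 2) / (gen q (.e 1) * gen q (.e 7)) /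
      (gen q (.h 1) / gen q (.e 7) * gen q (.e 10) * gen q (.e 11)))
      = gen q .x * (gen q (.h 2) / (gen q (.e 1) * gen q (.e 10) * gen q (.e 11))) :=
    eq_of_terms (by decide +kernel)
  have hPQ : (1 + gen q .x / gen q (.e 1)) * ((1 + gen q .x * (gen q (.e 7) / gen q (.h 1))) /
      (1 + gen q .x / gen q (.e 1))) = 1 + gen q .x * (gen q (.e 7) / gen q (.h 1)) := by
    have h : Commute (1 + gen q .x * (gen q (.e 7) / gen q (.h 1)))
        (1 + gen q .x / gen q (.e 1)) := eq_of_terms (by decide +kernel)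
    rw [← mul_div_assoc, ← h.eq, mul_div_cancel_right₀ _ hQ0]
  obtain ⟨a, ha⟩ : ∃ a, a = 1 + gen q .x * (gen q (.e 7) /
      (gen q (.h 1) * gen q (.h 2) / (gen q (.e 10) * gen q (.e 11)))) +
      (1 + gen q .x * (gen q (.e 7) / gen q (.h 1))) * gen q .y * gen q (.e 11) := ⟨_, rfl⟩
  -- The factor `1` gives the middle summand the shape required by `add_mul_div_mul_mul`, with `D =
  -- 1`.
  obtain ⟨b, hb⟩ : ∃ b, b = 1 + gen q .x / gen q (.e 1) + 1 * gen q .y * gen q (.e 11) +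
      gen q .x * (gen q (.h 2) / (gen q (.e 1) * gen q (.e 10) * gen q (.e 11))) * gen q .y *
        gen q (.e 11) := ⟨_, rfl⟩
  -- Again `b` with one summand shifted by a power of $q$, now as $xyx^{-1}=q^{-1}y$.
  obtain ⟨n, hn⟩ : ∃ n, n = 1 + gen q .x / gen q (.e 1) +
      gen q .x * gen q .y * ((gen q .x)⁻¹ * gen q (.e 11)) +
      gen q .x * (gen q (.h 2) / (gen q (.e 1) * gen q (.e 10) * gen q (.e 11))) * gen q .y *
        gen q (.e 11) := ⟨_, rfl⟩
  have hφP : φ (1 + gen q .x * (gen q (.e 7) / gen q (.h 1)))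
      = a * (1 + gen q .y * gen q (.e 11))⁻¹ := by
    simp only [hφ.s₀_eqs, map_div₀, map_mul, map_add, map_one]
    rw [one_add_mul_div_mul hG0 (eq_of_terms (by decide +kernel)), ha]
    exact congrArg (· * _) (eq_of_terms (by decide +kernel))
  have hφQ : φ (1 + gen q .x / gen q (.e 1)) = b * (1 + gen q .y * gen q (.e 11))⁻¹ := by
    simp only [hφ.s₀_eqs, map_div₀, map_add, map_one]
    rw [div_eq_mul_inv _ (gen q (.e 1)),
      one_add_mul_div_mul hG0 (eq_of_terms (by decide +kernel)), hb]
    exact congrArg (· * _) (eq_of_terms (by decide +kernel))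
  have hψa : ψ a = a := by
    rw [ha]
    simp only [hψ.s₃_eqs, map_div₀, map_mul, map_add, map_one]
    rw [he, ← mul_assoc (1 + gen q .x / _), hPQ]
    exact congrArg (· + _) (eq_of_terms (by decide +kernel))
  have hψb : ψ b = (1 + gen q .x * (gen q (.e 7) / gen q (.h 1))) /
      (1 + gen q .x / gen q (.e 1)) * b := by
    rw [hb]
    simp only [hψ.s₃_eqs, map_div₀, map_mul, map_add, map_one]
    rw [he', hd, add_mul_div_mul_mul hQ0 (eq_of_terms (by decide +kernel))
      (eq_of_terms (by decide +kernel)) (eq_of_terms (by decide +kernel))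
      (eq_of_terms (by decide +kernel))]
  have hψn : ψ n = (1 + gen q .x * (gen q (.e 7) / gen q (.h 1))) /
      (1 + gen q .x / gen q (.e 1)) * n := by
    rw [hn]
    simp only [hψ.s₃_eqs, map_div₀, map_mul, map_add, map_one, map_inv₀]
    rw [he', hd, add_mul_div_mul_mul hQ0 (eq_of_terms (by decide +kernel))
      (eq_of_terms (by decide +kernel)) (eq_of_terms (by decide +kernel))
      (eq_of_terms (by decide +kernel))]
  have hψk : ψ (gen q (.σ 2) / gen q (.τ 7)) = gen q (.σ 2) / gen q (.τ 7) := by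
    simp only [hψ.s₃_eqs, map_div₀]
    rw [mul_div_mul_right _ _ hQ0]
    exact eq_of_terms (by decide +kernel)
  have hψm : ψ (gen q (.σ 1) * gen q (.σ 2) / (gen q (.τ 1) * (gen q (.τ 10) * gen q (.τ 11))))
      = gen q (.σ 1) * gen q (.σ 2) / (gen q (.τ 1) * (gen q (.τ 10) * gen q (.τ 11))) *
        ((1 + gen q .x / gen q (.e 1)) / (1 + gen q .x * (gen q (.e 7) / gen q (.h 1)))) := by
    simp only [hψ.s₃_eqs, map_div₀, map_mul]
    rw [← mul_assoc (gen q (.σ 1)), mul_assoc (1 + _),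
      mul_div_mul_left_of_commute_right (eq_of_terms (by decide +kernel))]
    exact congrArg (· * _) (eq_of_terms (by decide +kernel))
  have hmn : ∀ m, m * ((1 + gen q .x / gen q (.e 1)) /
      (1 + gen q .x * (gen q (.e 7) / gen q (.h 1)))) *
      ((1 + gen q .x * (gen q (.e 7) / gen q (.h 1))) / (1 + gen q .x / gen q (.e 1)) * n)
      = m * n := fun m => by
    rw [mul_assoc, ← mul_assoc (_ / _), div_mul_div_cancel₀ hP0, div_self hQ0, one_mul]
  simp only [moved₃, List.mem_cons, List.not_mem_nil, or_false] at hg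
  rcases hg with rfl | rfl | rfl | rfl | rfl | rfl | rfl
  · simp only [hφ.s₀_eqs, hψ.s₃_eqs, map_div₀, map_mul]
    exact eq_of_terms (by decide +kernel)
  · simp only [hφ.s₀_eqs, hψ.s₃_eqs, map_div₀, map_mul]
    exact eq_of_terms (by decide +kernel)
  · simp only [hφ.s₀_eqs, hψ.s₃_eqs, map_div₀, map_mul]
    exact eq_of_terms (by decide +kernel)
  · have hz : φ (ψ (gen q .y)) = a / b * gen q .y := by
      rw [hψ.s₃_eqs.2.2.2.1, map_mul, map_div₀, hφP, hφQ, mul_div_mul_right _ _ (inv_ne_zero hG0),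
        hφ .y]
      rfl
    rw [hz]
    simp only [map_mul, map_div₀, hψa, hψb, hψ.s₃_eqs]
    rw [← mul_assoc, div_mul_left_mul_cancel (div_ne_zero hP0 hQ0)]
  · have hz : φ (ψ (gen q (.τ 1))) = a * (gen q (.σ 2) / gen q (.τ 7) *
        (gen q (.σ 1) / (gen q (.τ 10) * gen q (.τ 11)))) := by
      rw [hψ.s₃_eqs.2.2.2.2.1, map_mul, hφP]
      simp only [map_div₀, hφ.s₀_eqs]
      rw [mul_assoc, mul_div_assoc, inv_mul_cancel_left₀ hG0]
      exact congrArg _ (eq_of_terms (by decide +kernel))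
    rw [hz, map_mul, map_mul, hψk, hψa]
    simp only [map_div₀, map_mul, hψ.s₃_eqs]
  · have hz : φ (ψ (gen q (.τ 7))) = gen q (.σ 1) * gen q (.σ 2) /
        (gen q (.τ 1) * (gen q (.τ 10) * gen q (.τ 11))) * n := by
      rw [hψ.s₃_eqs.2.2.2.2.2.1, map_mul, hφQ]
      simp only [map_div₀, hφ.s₀_eqs]
      rw [← mul_assoc, mul_inv_eq_iff_eq_mul₀ hG0, hb, hn]
      exact eq_of_terms (by decide +kernel)
    rw [hz, map_mul, hψn, hψm, hmn]
  · have hz : φ (ψ (gen q (.σ 2))) = gen q (.σ 2) / gen q (.τ 7) *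
        (gen q (.σ 1) * gen q (.σ 2) / (gen q (.τ 1) * (gen q (.τ 10) * gen q (.τ 11))) * n) := by
      rw [hψ.s₃_eqs.2.2.2.2.2.2.1, map_mul, hφQ]
      simp only [map_div₀, map_mul, hφ.s₀_eqs]
      rw [← mul_assoc, mul_inv_eq_iff_eq_mul₀ hG0, hb, hn]
      exact eq_of_terms (by decide +kernel)
    rw [hz, map_mul, map_mul, hψk, hψn, hψm, hmn]

lemma ActsBy.s₀_braid_s₃ {φ ψ : SkewK q →ₐ[𝕜] SkewK q} (hφ : ActsBy φ (s₀Image q))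
    (hψ : ActsBy ψ (s₃Image q)) (g : Gen) : φ (ψ (φ (gen q g))) = ψ (φ (ψ (gen q g))) := by
  have h1 : ∀ g ∉ moved₀, φ (gen q g) = gen q g := fun g hg => by rw [hφ, s₀Image_of_notMem hg]
  have h2 : ∀ g ∉ moved₃, ψ (gen q g) = gen q g := fun g hg => by rw [hψ, s₃Image_of_notMem hg]
  have h3 : ∀ g ∈ moved₃, g ∉ moved₀ := by decide
  by_cases hg : g ∈ moved₃
  · rw [h1 g (h3 g hg), hφ.s₀_braid_s₃_right hψ hg]
  · rw [h2 g hg]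
    by_cases hg' : g ∈ moved₀
    · exact hφ.s₀_braid_s₃_left hψ hg'
    · rw [h1 g hg', h2 g hg, h1 g hg']

end Braid

/-! ### Assembling the Coxeter relations of type $E_8^{(1)}$. -/

section Coxeter

variable {𝕜 : Type*} [Field 𝕜] {q : 𝕜ˣ}

lemma skewK_algEquiv_ext {s t : SkewK q ≃ₐ[𝕜] SkewK q} (h : ∀ g, s (gen q g) = t (gen q g)) :
    s = t :=
  AlgEquiv.coe_toAlgHom_injective (QFrac.algHom_ext h)

/-- The permutations of the indices which define the `s_i` with `i ≠ 0, 3`. -/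
def indexPerm : Fin 9 → Equiv.Perm (Fin 11) :=
  ![1, Equiv.swap 8 9, Equiv.swap 7 8, 1, Equiv.swap 1 2, Equiv.swap 2 3, Equiv.swap 3 4,
    Equiv.swap 4 5, Equiv.swap 5 6]

lemma sImage_eq_permGen {i : Fin 9} (h0 : i ≠ 0) (h3 : i ≠ 3) :
    sImage q i = fun g => gen q (permGen (indexPerm i) g) := by
  fin_cases i
  · exact absurd rfl h0
  · exact swapImage_eq _ _
  · exact swapImage_eq _ _
  · exact absurd rfl h3
  all_goals exact swapImage_eq _ _

variable (q) in
lemma exists_actsBy_sImage (i : Fin 9) : ∃ φ : SkewK q →ₐ[𝕜] SkewK q, ActsBy φ (sImage q i) := by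
  by_cases h0 : i = 0
  · subst h0
    exact exists_actsBy_s₀Image q
  by_cases h3 : i = 3
  · subst h3
    exact exists_actsBy_s₃Image q
  rw [sImage_eq_permGen h0 h3]
  exact exists_actsBy_permGen q _

lemma ActsBy.sImage_involutive {i : Fin 9} {φ : SkewK q →ₐ[𝕜] SkewK q} (h : ActsBy φ (sImage q i)) :
    φ.comp φ = AlgHom.id 𝕜 (SkewK q) := by
  refine QFrac.algHom_ext fun g => ?_
  by_cases h0 : i = 0
  · subst h0
    exact ActsBy.s₀_involutive h g
  by_cases h3 : i = 3
  · subst h3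
    exact ActsBy.s₃_involutive h g
  rw [sImage_eq_permGen h0 h3] at h
  refine (h.permGen_mul h g).trans ?_
  have : indexPerm i * indexPerm i = 1 := by
    clear h
    revert i
    decide +kernel
  dsimp only
  rw [this, permGen_one]
  rfl

/-- The Coxeter relation between two involutions joined by an edge, or not joined. -/
def CoxeterRel {G : Type*} [Mul G] (i j : Fin 9) (a b : G) : Prop :=
  if affineE₈Edge i j then a * b * a = b * a * b else a * b = b * a

instance {G : Type*} [Mul G] [DecidableEq G] (i j : Fin 9) (a b : G) :
    Decidable (CoxeterRel i j a b) := by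
  unfold CoxeterRel
  infer_instance

lemma affineE₈Edge_comm (i j : Fin 9) : affineE₈Edge i j ↔ affineE₈Edge j i := by
  revert i j
  decide

lemma CoxeterRel.symm {G : Type*} [Mul G] {i j : Fin 9} {a b : G} (h : CoxeterRel i j a b) :
    CoxeterRel j i b a := by
  unfold CoxeterRel at h ⊢
  simp only [affineE₈Edge_comm j i]
  split_ifs at h ⊢
  · exact h.symm
  · exact h.symm

lemma CoxeterRel.pow_eq_one {G : Type*} [Group G] {i j : Fin 9} {a b : G} (hij : i ≠ j)
    (ha : a * a = 1) (hb : b * b = 1) (h : CoxeterRel i j a b) : (a * b) ^ affineE₈ i j = 1 := by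
  have hM : affineE₈ i j = if affineE₈Edge i j then 3 else 2 := if_neg hij
  rw [hM]
  unfold CoxeterRel at h
  split_ifs at h ⊢
  · calc (a * b) ^ 3 = a * b * a * (b * a * b) := by simp only [pow_succ, pow_zero]; group
      _ = a * (b * (a * a) * b) * a := by rw [← h]; group
      _ = 1 := by rw [ha, mul_one, hb, mul_one, ha]
  · calc (a * b) ^ 2 = a * b * (b * a) := by rw [pow_two, ← h]
      _ = a * (b * b) * a := by group
      _ = 1 := by rw [hb, mul_one, ha]

/-- Index permutations act compatibly with composition, so the relation reduces to a finite check in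
the symmetric group on 11 letters. -/
lemma coxeterRel_of_actsBy_permGen {i j : Fin 9} (hi0 : i ≠ 0) (hi3 : i ≠ 3) (hj0 : j ≠ 0)
    (hj3 : j ≠ 3) (hij : i ≠ j) {s t : SkewK q ≃ₐ[𝕜] SkewK q}
    (hs : ActsBy (s : SkewK q →ₐ[𝕜] SkewK q) (sImage q i))
    (ht : ActsBy (t : SkewK q →ₐ[𝕜] SkewK q) (sImage q j)) : CoxeterRel i j s t := by
  have h : CoxeterRel i j (indexPerm i) (indexPerm j) := by
    clear hs ht
    revert i j
    decide +kernel
  rw [sImage_eq_permGen hi0 hi3] at hs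
  rw [sImage_eq_permGen hj0 hj3] at ht
  unfold CoxeterRel at h ⊢
  split_ifs at h ⊢
  · have h1 := (hs.permGen_mul ht).permGen_mul hs
    have h2 := (ht.permGen_mul hs).permGen_mul ht
    rw [h] at h1
    exact skewK_algEquiv_ext fun g => (h1 g).trans (h2 g).symm
  · have h1 := hs.permGen_mul ht
    have h2 := ht.permGen_mul hs
    rw [h] at h1
    exact skewK_algEquiv_ext fun g => (h1 g).trans (h2 g).symm

lemma coxeterRel_of_actsBy_s₀ {j : Fin 9} (hj : j ≠ 0) {s t : SkewK q ≃ₐ[𝕜] SkewK q}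
    (hs : ActsBy (s : SkewK q →ₐ[𝕜] SkewK q) (s₀Image q))
    (ht : ActsBy (t : SkewK q →ₐ[𝕜] SkewK q) (sImage q j)) : CoxeterRel 0 j s t := by
  unfold CoxeterRel
  by_cases h3 : j = 3
  · subst h3
    rw [if_pos (by decide)]
    exact skewK_algEquiv_ext fun g => hs.s₀_braid_s₃ ht g
  · rw [sImage_eq_permGen hj h3] at ht
    -- Every other node is unjoined to $0$, and its permutation of the indices fixes $10$ and $11$,
    -- the only ones that $s_0$ involves.
    have h : ¬ affineE₈Edge 0 j ∧ ∀ g ∈ moved₀, permGen (indexPerm j) g = g := by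
      clear ht
      revert j
      decide +kernel
    rw [if_neg h.1]
    exact skewK_algEquiv_ext fun g => hs.s₀_comm_permGen ht h.2 g

lemma coxeterRel_of_actsBy_s₃ {j : Fin 9} (hj0 : j ≠ 0) (hj3 : j ≠ 3)
    {s t : SkewK q ≃ₐ[𝕜] SkewK q} (hs : ActsBy (s : SkewK q →ₐ[𝕜] SkewK q) (s₃Image q))
    (ht : ActsBy (t : SkewK q →ₐ[𝕜] SkewK q) (sImage q j)) : CoxeterRel 3 j s t := by
  unfold CoxeterRel
  by_cases h2 : j = 2
  · subst h2
    rw [if_pos (by decide)]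
    exact skewK_algEquiv_ext fun g => hs.s₃_braid_swap_7_8 ht g
  by_cases h4 : j = 4
  · subst h4
    rw [if_pos (by decide)]
    exact skewK_algEquiv_ext fun g => hs.s₃_braid_swap_1_2 ht g
  rw [sImage_eq_permGen hj0 hj3] at ht
  have h : ¬ affineE₈Edge 3 j ∧ ∀ g ∈ moved₃, permGen (indexPerm j) g = g := by
    clear ht
    revert j
    decide +kernel
  rw [if_neg h.1]
  exact skewK_algEquiv_ext fun g => hs.s₃_comm_permGen ht h.2 g

lemma coxeterRel_of_actsBy {i j : Fin 9} (hij : i ≠ j) {s t : SkewK q ≃ₐ[𝕜] SkewK q}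
    (hs : ActsBy (s : SkewK q →ₐ[𝕜] SkewK q) (sImage q i))
    (ht : ActsBy (t : SkewK q →ₐ[𝕜] SkewK q) (sImage q j)) : CoxeterRel i j s t := by
  by_cases hi0 : i = 0
  · subst hi0
    exact coxeterRel_of_actsBy_s₀ hij.symm hs ht
  by_cases hj0 : j = 0
  · subst hj0
    exact (coxeterRel_of_actsBy_s₀ hij ht hs).symm
  by_cases hi3 : i = 3
  · subst hi3
    exact coxeterRel_of_actsBy_s₃ hj0 hij.symm hs ht
  by_cases hj3 : j = 3
  · subst hj3
    exact (coxeterRel_of_actsBy_s₃ hi0 hij ht hs).symm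
  exact coxeterRel_of_actsBy_permGen hi0 hi3 hj0 hj3 hij hs ht

end Coxeter

theorem mainTheorem2 {𝕜 : Type*} [Field 𝕜] (q : 𝕜ˣ) :
    ∃ s : Fin 9 → (SkewK q ≃ₐ[𝕜] SkewK q),
      (∀ i g, s i (gen q g) = sImage q i g) ∧
      (∀ i, ∀ t : SkewK q ≃ₐ[𝕜] SkewK q, (∀ g, t (gen q g) = sImage q i g) → t = s i) ∧
      (∀ i j, (s i * s j) ^ affineE₈ i j = 1) ∧
      ∃ ρ : affineE₈.Group →* (SkewK q ≃ₐ[𝕜] SkewK q), ∀ i, ρ (affineE₈.simple i) = s i := by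
  choose φ hφ using exists_actsBy_sImage q
  have hinv := fun i => (hφ i).sImage_involutive
  let s : Fin 9 → (SkewK q ≃ₐ[𝕜] SkewK q) := fun i =>
    AlgEquiv.ofAlgHom (φ i) (φ i) (hinv i) (hinv i)
  have hs : ∀ i g, s i (gen q g) = sImage q i g := hφ
  have hss : ∀ i, s i * s i = 1 := fun i =>
    AlgEquiv.ext fun z => DFunLike.congr_fun (hinv i) z
  have hrel : ∀ i j, (s i * s j) ^ affineE₈ i j = 1 := fun i j => by
    by_cases hij : i = j
    · subst hij
      rw [affineE₈.diagonal, pow_one, hss]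
    · exact (coxeterRel_of_actsBy hij (hs i) (hs j)).pow_eq_one hij (hss i) (hss j)
  exact ⟨s, hs, fun i t ht => skewK_algEquiv_ext fun g => (ht g).trans (hs i g).symm, hrel,
    affineE₈.toCoxeterSystem.lift ⟨s, hrel⟩, affineE₈.toCoxeterSystem.lift_apply_simple hrel⟩
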